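/- Let $\mathbb C$ be a semi-abelian category (pointed, finitely complete and finitely cocomplete, Barr exact and protomodular). For morphisms $x\colon X\to A$, $y\colon Y\to A$, $w\colon W\to A$, write $(W+X)\times_W(W+Y)$ for the pullback of the morphisms $[1,0]\colon W+X\to W$ and $[1,0]\colon W+Y\to W$. An \emph{internal multiplication} $X\times Y\to A$ over $(W,w)$ is a morphism $m\colon (W+X)\times_W(W+Y)\to A$ with $m\langle 1,\iota_1[1,0]\rangle=[w,x]$ and $m\langle \iota_1[1,0],1\rangle=[w,y]$. Let $q=\langle[\iota_1,\iota_2,0],[\iota_1,0,\iota_2]\rangle\colon W+X+Y\to (W+X)\times_W(W+Y)$. The \emph{weighted subobject commutator} $\kappa\colon[(X,x),(Y,y)]_{(W,w)}\to A$ is the image under $[w,x,y]\colon W+X+Y\to A$ of the kernel of $q$. The \emph{weighted normal commutator} $\kappa_N\colon N[(X,x),(Y,y)]_{(W,w)}\to A$ is the kernel of the morphism $\nu\colon A\to\tilde C$ obtained as the pushout of $q$ along $[w,x,y]$. The index $1$ means $(W,w)=(A,1_A)$ (the $1$-weighted case). An \emph{internal pregroupoid} is a span $S_0\xleftarrow{d}S_1\xrightarrow{c}S_0'$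 with a morphism $p\colon S_1\times_{S_0}S_1\times_{S_0'}S_1\to S_1$ (defined on triples $(a,b,e)$ with $d(a)=d(b)$ and $c(b)=c(e)$) such that $p(a,b,b)=a$ and $p(a,a,b)=b$; morphisms are the span morphisms preserving $p$. Let $\mathsf{NEpiS}(\mathbb C)$ and $\mathsf{NEpiPgrd}(\mathbb C)$ be the categories of spans, respectively of internal pregroupoids, in which $d$ and $c$ are normal epimorphisms. Let $\mathsf{NMonoCS}_1(\mathbb C)$ be the category of $1$-weighted cospans $(A,X,x,Y,y,A,1_A)$ with $x,y$ normal monomorphisms, and $\mathsf{NMonoMCS}_1(\mathbb C)$ the category of such cospans equipped with an internal multiplication over $(A,1_A)$, with morphisms the diagram morphisms compatible with the multiplications. The \emph{Pedicchio commutator} $[E,E']$ of equivalence relations $E,E'$ on $A$ is the kernel pair of the $A$-component of the reflection (universal morphism) of the span $A/E\leftarrow A\to A/E'$ into internal pregroupoids. An equivalence relation $E$ on $A$ and a normal monomorphism $x\colon X\to A$ correspond to each other when $x$ is the kernel of $A\to A/E$, equivalently $E=A\times_{A/X}A$ is the kernel pair of the cokernel of $x$. Then the functor sending a span $S_0\xleftarrow{d}S_1\xrightarrow{c}S_0'$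 to $(S_1,\mathsf{Ker}(d),\ker(d),\mathsf{Ker}(c),\ker(c),S_1,1)$ is an equivalence $\mathsf{NEpiS}(\mathbb C)\simeq\mathsf{NMonoCS}_1(\mathbb C)$, and it induces an equivalence $\mathsf{NEpiPgrd}(\mathbb C)\simeq\mathsf{NMonoMCS}_1(\mathbb C)$, under which a pregroupoid structure $p$ goes to the internal multiplication $p\gamma$, where $\gamma=\langle[1,\ker(d)]\pi_1,[1,0]\pi_1,[1,\ker(c)]\pi_2\rangle$. Moreover: (a) for every two equivalence relations $E,E'$ on an object $A$, the Pedicchio commutator $[E,E']$ exists and is the equivalence relation corresponding to the normal monomorphism $\kappa_N\colon N[(X,x),(Y,y)]_1\to A$, where $x$ and $y$ are the normal monomorphisms corresponding to $E$ and $E'$; (b) for every two normal monomorphisms $x\colon X\to A$ and $y\colon Y\to A$, the morphism $\kappa_N\colon N[(X,x),(Y,y)]_1\to A$ is the normal monomorphism corresponding to the Pedicchio commutator $[E,E']$, where $E$ and $E'$ are the equivalence relations on $A$ corresponding to $x$ and $y$; (c) for every two normal monomorphisms $x\colon X\to A$ and $y\colon Y\to A$, one has $N[(X,x),(Y,y)]_1=[(X,x),(Y,y)]_1$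 as subobjects of $A$; hence (a) and (b) apply equally to the $1$-weighted subobject commutator. -/

import Mathlib

open CategoryTheory CategoryTheory.Limits

universe v u

noncomputable section

namespace WeightedCommutator

variable {C : Type u} [Category.{v} C]

/-! ### Semi-abelian categories -/

/-- A semi-abelian category: pointed, finitely complete, with binary (hence, by the zero object,
finite) coproducts, Barr exact (regular, and every internal equivalence relation is a kernel pair)
and protomodular (in the pointed, finitely complete case: the Split Short Five Lemma holds). -/
class SemiAbelian (C : Type u) [Category.{v} C] [HasZeroMorphisms C] : Prop extends
    Regular C, HasZeroObject C, HasBinaryCoproducts C where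
  effective : ∀ {R A : C} (p₁ p₂ : R ⟶ A), IsEquivalenceRelation p₁ p₂ →
    ∃ (B : C) (f : A ⟶ B), IsKernelPair f p₁ p₂
  split_short_five : ∀ {A A' B B' : C} (p : A ⟶ B) (s : B ⟶ A) (p' : A' ⟶ B') (s' : B' ⟶ A')
    (f : A ⟶ A') (g : B ⟶ B'), s ≫ p = 𝟙 B → s' ≫ p' = 𝟙 B' → s ≫ f = g ≫ s' →
    ∀ (h : p ≫ g = f ≫ p'), IsIso (kernel.map p p' f g h) → IsIso g → IsIso f

/-- `f` is a kernel of some morphism. -/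
def IsNormalMono [HasZeroMorphisms C] {X Y : C} (f : X ⟶ Y) : Prop := Nonempty (NormalMono f)

/-- `f` is a cokernel of some morphism. -/
def IsNormalEpi [HasZeroMorphisms C] {X Y : C} (f : X ⟶ Y) : Prop := Nonempty (NormalEpi f)

lemma isNormalMono_kernel_ι {C : Type u} [Category.{v} C] [HasZeroMorphisms C] [HasKernels C]
    {X Y : C} (f : X ⟶ Y) : IsNormalMono (kernel.ι f) :=
  ⟨⟨Y, f, kernel.condition f, kernelIsKernel f⟩⟩

/-! ### Spans and internal pregroupoids -/

/-- A span `S₀ ⟵ S₁ ⟶ S₀'`. -/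
structure Spn (C : Type u) [Category.{v} C] where
  S₁ : C
  S₀ : C
  S₀' : C
  d : S₁ ⟶ S₀
  c : S₁ ⟶ S₀'

namespace Spn

/-- Morphisms of spans are morphisms of diagrams. -/
@[ext]
structure Hom (S T : Spn C) where
  f₁ : S.S₁ ⟶ T.S₁
  f₀ : S.S₀ ⟶ T.S₀
  f₀' : S.S₀' ⟶ T.S₀'
  comm_d : S.d ≫ f₀ = f₁ ≫ T.d
  comm_c : S.c ≫ f₀' = f₁ ≫ T.c

instance : Category (Spn C) where
  Hom S T := Hom S T
  id S := { f₁ := 𝟙 _, f₀ := 𝟙 _, f₀' := 𝟙 _, comm_d := by simp, comm_c := by simp }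
  comp f g :=
    { f₁ := f.f₁ ≫ g.f₁
      f₀ := f.f₀ ≫ g.f₀
      f₀' := f.f₀' ≫ g.f₀'
      comm_d := by rw [← Category.assoc, f.comm_d, Category.assoc, g.comm_d, Category.assoc]
      comm_c := by rw [← Category.assoc, f.comm_c, Category.assoc, g.comm_c, Category.assoc] }
  id_comp f := by apply Hom.ext <;> simp
  comp_id f := by apply Hom.ext <;> simp
  assoc f g h := by apply Hom.ext <;> simp

@[simp] lemma id_f₁ (S : Spn C) : Hom.f₁ (𝟙 S) = 𝟙 _ := rfl
@[simp] lemma comp_f₁ {S T U : Spn C} (f : S ⟶ T) (g : T ⟶ U) :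
    Hom.f₁ (f ≫ g) = Hom.f₁ f ≫ Hom.f₁ g := rfl

@[ext]
lemma hom_ext {S T : Spn C} {f g : S ⟶ T} (h₁ : Hom.f₁ f = Hom.f₁ g) (h₀ : Hom.f₀ f = Hom.f₀ g)
    (h₀' : Hom.f₀' f = Hom.f₀' g) : f = g := Hom.ext h₁ h₀ h₀'

variable [HasPullbacks C]

/-- The object `S₃ = S₁ ×_{S₀} S₁ ×_{S₀'} S₁` of triples `(a, b, e)` with `d a = d b` and
`c b = c e`. -/
abbrev triple (S : Spn C) : C := pullback (pullback.snd S.d S.d) (pullback.fst S.c S.c)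

/-- The morphism `⟨a, b, e⟩` into `S₃`. -/
def tripleLift (S : Spn C) {T : C} (a b e : T ⟶ S.S₁) (h : a ≫ S.d = b ≫ S.d)
    (h' : b ≫ S.c = e ≫ S.c) : T ⟶ S.triple :=
  pullback.lift (pullback.lift a b h) (pullback.lift b e h')
    (by simp [pullback.lift_fst, pullback.lift_snd])

/-- First projection. -/
def pr₁ (S : Spn C) : S.triple ⟶ S.S₁ := pullback.fst _ _ ≫ pullback.fst _ _

/-- Second projection. -/
def pr₂ (S : Spn C) : S.triple ⟶ S.S₁ := pullback.fst _ _ ≫ pullback.snd _ _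

/-- Third projection. -/
def pr₃ (S : Spn C) : S.triple ⟶ S.S₁ := pullback.snd _ _ ≫ pullback.snd _ _

lemma pr₁_d (S : Spn C) : S.pr₁ ≫ S.d = S.pr₂ ≫ S.d := by
  simp only [pr₁, pr₂, Category.assoc]
  rw [pullback.condition]

lemma pr₂_c (S : Spn C) : S.pr₂ ≫ S.c = S.pr₃ ≫ S.c := by
  have h : S.pr₂ = pullback.snd _ _ ≫ pullback.fst _ _ := pullback.condition
  rw [h]
  simp only [pr₃, Category.assoc]
  rw [pullback.condition]

lemma tripleLift_pr₁ (S : Spn C) {T : C} (a b e : T ⟶ S.S₁) (h : a ≫ S.d = b ≫ S.d)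
    (h' : b ≫ S.c = e ≫ S.c) : S.tripleLift a b e h h' ≫ S.pr₁ = a := by
  simp [tripleLift, pr₁, pullback.lift_fst_assoc, pullback.lift_fst]

lemma tripleLift_pr₂ (S : Spn C) {T : C} (a b e : T ⟶ S.S₁) (h : a ≫ S.d = b ≫ S.d)
    (h' : b ≫ S.c = e ≫ S.c) : S.tripleLift a b e h h' ≫ S.pr₂ = b := by
  simp [tripleLift, pr₂, pullback.lift_fst_assoc, pullback.lift_snd]

lemma tripleLift_pr₃ (S : Spn C) {T : C} (a b e : T ⟶ S.S₁) (h : a ≫ S.d = b ≫ S.d)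
    (h' : b ≫ S.c = e ≫ S.c) : S.tripleLift a b e h h' ≫ S.pr₃ = e := by
  simp [tripleLift, pr₃, pullback.lift_snd_assoc, pullback.lift_snd]

lemma triple_hom_ext (S : Spn C) {T : C} {f g : T ⟶ S.triple} (h₁ : f ≫ S.pr₁ = g ≫ S.pr₁)
    (h₂ : f ≫ S.pr₂ = g ≫ S.pr₂) (h₃ : f ≫ S.pr₃ = g ≫ S.pr₃) : f = g := by
  have h : S.pr₂ = pullback.snd _ _ ≫ pullback.fst _ _ := pullback.condition
  apply pullback.hom_ext
  · apply pullback.hom_ext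
    · simpa only [pr₁, Category.assoc] using h₁
    · simpa only [pr₂, Category.assoc] using h₂
  · apply pullback.hom_ext
    · simpa only [h, Category.assoc] using h₂
    · simpa only [pr₃, Category.assoc] using h₃

lemma comp_tripleLift (S : Spn C) {T U : C} (t : U ⟶ T) (a b e : T ⟶ S.S₁)
    (h : a ≫ S.d = b ≫ S.d) (h' : b ≫ S.c = e ≫ S.c) :
    t ≫ S.tripleLift a b e h h' =
      S.tripleLift (t ≫ a) (t ≫ b) (t ≫ e) (by simp [h]) (by simp [h']) := by
  apply triple_hom_ext <;>
    simp only [Category.assoc, tripleLift_pr₁, tripleLift_pr₂, tripleLift_pr₃]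

lemma tripleLift_congr (S : Spn C) {T : C} {a b e a' b' e' : T ⟶ S.S₁} (ha : a = a') (hb : b = b')
    (he : e = e') (h : a ≫ S.d = b ≫ S.d) (h' : b ≫ S.c = e ≫ S.c) :
    S.tripleLift a b e h h' =
      S.tripleLift a' b' e' (by rw [← ha, ← hb, h]) (by rw [← hb, ← he, h']) := by
  subst ha hb he; rfl

/-- The morphism `S₃ ⟶ T₃` induced by a morphism of spans. -/
def tripleMap {S T : Spn C} (f : S ⟶ T) : S.triple ⟶ T.triple :=
  T.tripleLift (S.pr₁ ≫ Hom.f₁ f) (S.pr₂ ≫ Hom.f₁ f) (S.pr₃ ≫ Hom.f₁ f)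
    (by simp only [Category.assoc, ← Hom.comm_d]; rw [← Category.assoc, pr₁_d, Category.assoc])
    (by simp only [Category.assoc, ← Hom.comm_c]; rw [← Category.assoc, pr₂_c, Category.assoc])

lemma tripleLift_tripleMap {S T : Spn C} (f : S ⟶ T) {U : C} (a b e : U ⟶ S.S₁)
    (h : a ≫ S.d = b ≫ S.d) (h' : b ≫ S.c = e ≫ S.c) :
    S.tripleLift a b e h h' ≫ tripleMap f =
      T.tripleLift (a ≫ Hom.f₁ f) (b ≫ Hom.f₁ f) (e ≫ Hom.f₁ f)
        (by simp only [Category.assoc, ← Hom.comm_d]; rw [← Category.assoc, h, Category.assoc])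
        (by simp only [Category.assoc, ← Hom.comm_c]; rw [← Category.assoc, h', Category.assoc]) := by
  apply triple_hom_ext <;>
    simp only [tripleMap, Category.assoc, tripleLift_pr₁, tripleLift_pr₂, tripleLift_pr₃] <;>
    simp only [← Category.assoc, tripleLift_pr₁, tripleLift_pr₂, tripleLift_pr₃]

lemma tripleMap_id (S : Spn C) : tripleMap (𝟙 S) = 𝟙 _ := by
  apply triple_hom_ext <;>
    simp only [tripleMap, tripleLift_pr₁, tripleLift_pr₂, tripleLift_pr₃] <;> simp

lemma tripleMap_comp {S T U : Spn C} (f : S ⟶ T) (g : T ⟶ U) :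
    tripleMap (f ≫ g) = tripleMap f ≫ tripleMap g := by
  conv_rhs => rw [tripleMap, tripleLift_tripleMap]
  apply triple_hom_ext <;>
    simp only [tripleMap, tripleLift_pr₁, tripleLift_pr₂, tripleLift_pr₃] <;> simp

end Spn

/-- An internal pregroupoid: a span `S₀ ⟵ S₁ ⟶ S₀'` with a partial Mal'tsev operation
`p : S₁ ×_{S₀} S₁ ×_{S₀'} S₁ ⟶ S₁`, i.e. `p(a, b, b) = a` and `p(a, a, b) = b`. -/
structure Pgrd (C : Type u) [Category.{v} C] [HasPullbacks C] where
  toSpn : Spn C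
  p : toSpn.triple ⟶ toSpn.S₁
  p_right : toSpn.tripleLift (pullback.fst toSpn.d toSpn.d) (pullback.snd toSpn.d toSpn.d)
    (pullback.snd toSpn.d toSpn.d) pullback.condition rfl ≫ p = pullback.fst toSpn.d toSpn.d
  p_left : toSpn.tripleLift (pullback.fst toSpn.c toSpn.c) (pullback.fst toSpn.c toSpn.c)
    (pullback.snd toSpn.c toSpn.c) rfl pullback.condition ≫ p = pullback.snd toSpn.c toSpn.c

namespace Pgrd

variable [HasPullbacks C]

lemma p_abb (P : Pgrd C) {T : C} (a b : T ⟶ P.toSpn.S₁) (h : a ≫ P.toSpn.d = b ≫ P.toSpn.d) :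
    P.toSpn.tripleLift a b b h rfl ≫ P.p = a := by
  have := congrArg (fun q => pullback.lift a b h ≫ q) P.p_right
  simp only [← Category.assoc, Spn.comp_tripleLift] at this
  simpa only [pullback.lift_fst, pullback.lift_snd] using this

lemma p_aab (P : Pgrd C) {T : C} (a b : T ⟶ P.toSpn.S₁) (h : a ≫ P.toSpn.c = b ≫ P.toSpn.c) :
    P.toSpn.tripleLift a a b rfl h ≫ P.p = b := by
  have := congrArg (fun q => pullback.lift a b h ≫ q) P.p_left
  simp only [← Category.assoc, Spn.comp_tripleLift] at this
  simpa only [pullback.lift_fst, pullback.lift_snd] using this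

/-- Morphisms of pregroupoids are morphisms of spans preserving the operation. -/
@[ext]
structure Hom (P Q : Pgrd C) where
  toSpnHom : P.toSpn ⟶ Q.toSpn
  comm_p : P.p ≫ Spn.Hom.f₁ toSpnHom = Spn.tripleMap toSpnHom ≫ Q.p

instance : Category (Pgrd C) where
  Hom P Q := Hom P Q
  id P := { toSpnHom := 𝟙 _, comm_p := by simp [Spn.tripleMap_id] }
  comp f g :=
    { toSpnHom := f.toSpnHom ≫ g.toSpnHom
      comm_p := by
        rw [Spn.comp_f₁, ← Category.assoc, f.comm_p, Category.assoc, g.comm_p,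
          Spn.tripleMap_comp, Category.assoc] }
  id_comp f := by apply Hom.ext; simp
  comp_id f := by apply Hom.ext; simp
  assoc f g h := by apply Hom.ext; simp

/-- The forgetful functor from pregroupoids to spans. -/
def forget (C : Type u) [Category.{v} C] [HasPullbacks C] : Pgrd C ⥤ Spn C where
  obj P := P.toSpn
  map f := Hom.toSpnHom f

end Pgrd

/-! ### Internal multiplications over a weight -/

section Multiplication

variable [HasZeroMorphisms C] [HasBinaryCoproducts C] [HasPullbacks C]

/-- The morphism `[1, 0] : W + X ⟶ W`. -/
abbrev retr (W X : C) : W ⨿ X ⟶ W := coprod.desc (𝟙 W) 0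

lemma inl_retr (W X : C) : (coprod.inl : W ⟶ W ⨿ X) ≫ retr W X = 𝟙 W := coprod.inl_desc _ _

lemma inr_retr (W X : C) : (coprod.inr : X ⟶ W ⨿ X) ≫ retr W X = 0 := coprod.inr_desc _ _

/-- The object `(W + X) ×_W (W + Y)`, the pullback of `[1, 0]` along `[1, 0]`. -/
abbrev wprod (W X Y : C) : C := pullback (retr W X) (retr W Y)

/-- The morphism `⟨1, ι₁[1, 0]⟩ : W + X ⟶ (W + X) ×_W (W + Y)`. -/
def wprodLeft (W X Y : C) : W ⨿ X ⟶ wprod W X Y :=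
  pullback.lift (𝟙 _) (retr W X ≫ coprod.inl)
    (by rw [Category.assoc, inl_retr, Category.id_comp, Category.comp_id])

/-- The morphism `⟨ι₁[1, 0], 1⟩ : W + Y ⟶ (W + X) ×_W (W + Y)`. -/
def wprodRight (W X Y : C) : W ⨿ Y ⟶ wprod W X Y :=
  pullback.lift (retr W Y ≫ coprod.inl) (𝟙 _)
    (by rw [Category.assoc, inl_retr, Category.id_comp, Category.comp_id])

/-- The morphism `(W + X) ×_W (W + Y) ⟶ (W' + X') ×_{W'} (W' + Y')` induced by three morphisms. -/
def wprodMap {W X Y W' X' Y' : C} (h : W ⟶ W') (f : X ⟶ X') (g : Y ⟶ Y') :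
    wprod W X Y ⟶ wprod W' X' Y' :=
  pullback.map _ _ _ _ (coprod.map h f) (coprod.map h g) h (by ext <;> simp) (by ext <;> simp)

/-- `m` is an internal multiplication `X × Y ⟶ A` over `(W, w)`. -/
structure IsInternalMultiplication {A X Y W : C} (x : X ⟶ A) (y : Y ⟶ A) (w : W ⟶ A)
    (m : wprod W X Y ⟶ A) : Prop where
  left : wprodLeft W X Y ≫ m = coprod.desc w x
  right : wprodRight W X Y ≫ m = coprod.desc w y

/-- The canonical morphism `⟨[ι₁, ι₂, 0], [ι₁, 0, ι₂]⟩ : W + X + Y ⟶ (W + X) ×_W (W + Y)`. -/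
def canonicalMap (W X Y : C) : (W ⨿ X) ⨿ Y ⟶ wprod W X Y :=
  pullback.lift (coprod.desc (coprod.desc coprod.inl coprod.inr) 0)
    (coprod.desc (coprod.desc coprod.inl 0) coprod.inr)
    (by
      rw [coprod.desc_comp, coprod.desc_comp, coprod.desc_comp, coprod.desc_comp, inl_retr,
        inl_retr, inr_retr, inr_retr, zero_comp, zero_comp])

/-- The morphism `[w, x, y] : W + X + Y ⟶ A`. -/
abbrev copair {A X Y W : C} (x : X ⟶ A) (y : Y ⟶ A) (w : W ⟶ A) : (W ⨿ X) ⨿ Y ⟶ A :=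
  coprod.desc (coprod.desc w x) y

/-! ### Weighted commutators -/

/-- The `(W, w)`-weighted subobject commutator: the image under `[w, x, y]` of the kernel of the
canonical morphism `W + X + Y ⟶ (W + X) ×_W (W + Y)`. -/
def subobjectCommutator [HasKernels C] [HasImages C] {A X Y W : C} (x : X ⟶ A) (y : Y ⟶ A)
    (w : W ⟶ A) : image (kernel.ι (canonicalMap W X Y) ≫ copair x y w) ⟶ A :=
  image.ι _

instance [HasKernels C] [HasImages C] {A X Y W : C} (x : X ⟶ A) (y : Y ⟶ A) (w : W ⟶ A) :
    Mono (subobjectCommutator x y w) := by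
  unfold subobjectCommutator; infer_instance

variable [HasPushouts C]

/-- The morphism `ν : A ⟶ Ã` into the pushout of the canonical morphism
`W + X + Y ⟶ (W + X) ×_W (W + Y)` and `[w, x, y]`. -/
def commutatorQuotient {A X Y W : C} (x : X ⟶ A) (y : Y ⟶ A) (w : W ⟶ A) :
    A ⟶ pushout (canonicalMap W X Y) (copair x y w) :=
  pushout.inr _ _

/-- The `(W, w)`-weighted normal commutator: the kernel of `ν`. -/
def normalCommutator [HasKernels C] {A X Y W : C} (x : X ⟶ A) (y : Y ⟶ A) (w : W ⟶ A) :
    kernel (commutatorQuotient x y w) ⟶ A :=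
  kernel.ι _

instance [HasKernels C] {A X Y W : C} (x : X ⟶ A) (y : Y ⟶ A) (w : W ⟶ A) :
    Mono (normalCommutator x y w) := by
  unfold normalCommutator; infer_instance

end Multiplication

/-! ### Weighted cospans -/

/-- A weighted cospan: three morphisms `x`, `y`, `w` with the same codomain `A`. -/
structure WCospan (C : Type u) [Category.{v} C] where
  A : C
  X : C
  Y : C
  W : C
  x : X ⟶ A
  y : Y ⟶ A
  w : W ⟶ A

namespace WCospan

/-- Morphisms of weighted cospans are morphisms of diagrams. -/
@[ext]
structure Hom (S T : WCospan C) where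
  fA : S.A ⟶ T.A
  fX : S.X ⟶ T.X
  fY : S.Y ⟶ T.Y
  fW : S.W ⟶ T.W
  comm_x : S.x ≫ fA = fX ≫ T.x
  comm_y : S.y ≫ fA = fY ≫ T.y
  comm_w : S.w ≫ fA = fW ≫ T.w

instance : Category (WCospan C) where
  Hom S T := Hom S T
  id S :=
    { fA := 𝟙 _, fX := 𝟙 _, fY := 𝟙 _, fW := 𝟙 _
      comm_x := by simp, comm_y := by simp, comm_w := by simp }
  comp f g :=
    { fA := f.fA ≫ g.fA
      fX := f.fX ≫ g.fX
      fY := f.fY ≫ g.fY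
      fW := f.fW ≫ g.fW
      comm_x := by rw [← Category.assoc, f.comm_x, Category.assoc, g.comm_x, Category.assoc]
      comm_y := by rw [← Category.assoc, f.comm_y, Category.assoc, g.comm_y, Category.assoc]
      comm_w := by rw [← Category.assoc, f.comm_w, Category.assoc, g.comm_w, Category.assoc] }
  id_comp f := by apply Hom.ext <;> simp
  comp_id f := by apply Hom.ext <;> simp
  assoc f g h := by apply Hom.ext <;> simp

@[ext]
lemma hom_ext {S T : WCospan C} {f g : S ⟶ T} (hA : Hom.fA f = Hom.fA g)
    (hX : Hom.fX f = Hom.fX g) (hY : Hom.fY f = Hom.fY g) (hW : Hom.fW f = Hom.fW g) : f = g :=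
  Hom.ext hA hX hY hW

/-- The weighted cospan has the form `(A, X, x, Y, y, A, 1_A)`. -/
def IsOneWeighted (S : WCospan C) : Prop :=
  ∃ (A X Y : C) (x : X ⟶ A) (y : Y ⟶ A), S = ⟨A, X, Y, A, x, y, 𝟙 A⟩

end WCospan

section MCS

variable [HasZeroMorphisms C] [HasBinaryCoproducts C] [HasPullbacks C]

/-- A multiplicative weighted cospan. -/
structure MWCospan (C : Type u) [Category.{v} C] [HasZeroMorphisms C] [HasBinaryCoproducts C]
    [HasPullbacks C] where
  toWCospan : WCospan C
  m : wprod toWCospan.W toWCospan.X toWCospan.Y ⟶ toWCospan.A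
  isMul : IsInternalMultiplication toWCospan.x toWCospan.y toWCospan.w m

lemma wprodMap_id (W X Y : C) : wprodMap (𝟙 W) (𝟙 X) (𝟙 Y) = 𝟙 _ := by
  apply pullback.hom_ext <;> simp [wprodMap, pullback.map]

lemma wprodMap_comp {W X Y W' X' Y' W'' X'' Y'' : C} (h : W ⟶ W') (f : X ⟶ X') (g : Y ⟶ Y')
    (h' : W' ⟶ W'') (f' : X' ⟶ X'') (g' : Y' ⟶ Y'') :
    wprodMap (h ≫ h') (f ≫ f') (g ≫ g') = wprodMap h f g ≫ wprodMap h' f' g' := by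
  apply pullback.hom_ext <;>
    simp [wprodMap, pullback.map, pullback.lift_fst, pullback.lift_snd, pullback.lift_fst_assoc,
      pullback.lift_snd_assoc]

namespace MWCospan

/-- Morphisms of multiplicative weighted cospans are morphisms of weighted cospans compatible with
the multiplications. -/
@[ext]
structure Hom (S T : MWCospan C) where
  toWHom : S.toWCospan ⟶ T.toWCospan
  comm_m : S.m ≫ WCospan.Hom.fA toWHom =
    wprodMap (WCospan.Hom.fW toWHom) (WCospan.Hom.fX toWHom) (WCospan.Hom.fY toWHom) ≫ T.m

instance : Category (MWCospan C) where
  Hom S T := Hom S T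
  id S :=
    { toWHom := 𝟙 _
      comm_m := by
        change S.m ≫ 𝟙 _ = wprodMap (𝟙 _) (𝟙 _) (𝟙 _) ≫ S.m
        rw [wprodMap_id, Category.comp_id, Category.id_comp] }
  comp {S T U} f g :=
    { toWHom := f.toWHom ≫ g.toWHom
      comm_m := by
        change S.m ≫ f.toWHom.fA ≫ g.toWHom.fA = wprodMap (f.toWHom.fW ≫ g.toWHom.fW)
          (f.toWHom.fX ≫ g.toWHom.fX) (f.toWHom.fY ≫ g.toWHom.fY) ≫ U.m
        rw [← Category.assoc, f.comm_m, Category.assoc, g.comm_m, wprodMap_comp,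
          Category.assoc] }
  id_comp f := by apply Hom.ext; simp
  comp_id f := by apply Hom.ext; simp
  assoc f g h := by apply Hom.ext; simp

end MWCospan

/-! ### From spans to cospans, and from pregroupoids to multiplicative cospans -/

variable [HasKernels C]

/-- The functor sending a span `S₀ ⟵ S₁ ⟶ S₀'` with legs `d`, `c` to the `1`-weighted cospan
`(S₁, Ker d, ker d, Ker c, ker c, S₁, 1)`. -/
def kernelCospan (C : Type u) [Category.{v} C] [HasZeroMorphisms C] [HasKernels C] :
    Spn C ⥤ WCospan C where
  obj S := ⟨S.S₁, kernel S.d, kernel S.c, S.S₁, kernel.ι S.d, kernel.ι S.c, 𝟙 _⟩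
  map {S T} f :=
    { fA := f.f₁
      fX := kernel.map S.d T.d f.f₁ f.f₀ f.comm_d
      fY := kernel.map S.c T.c f.f₁ f.f₀' f.comm_c
      fW := f.f₁
      comm_x := by simp
      comm_y := by simp
      comm_w := by simp }
  map_id S := by
    apply WCospan.hom_ext
    · rfl
    · change kernel.map S.d S.d (𝟙 _) (𝟙 _) (by simp) = 𝟙 (kernel S.d)
      rw [← cancel_mono (kernel.ι S.d)]; simp
    · change kernel.map S.c S.c (𝟙 _) (𝟙 _) (by simp) = 𝟙 (kernel S.c)
      rw [← cancel_mono (kernel.ι S.c)]; simp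
    · rfl
  map_comp {S T U} f g := by
    apply WCospan.hom_ext
    · rfl
    · change kernel.map S.d U.d (f.f₁ ≫ g.f₁) (f.f₀ ≫ g.f₀) (Spn.Hom.comm_d (f ≫ g)) =
        kernel.map S.d T.d f.f₁ f.f₀ f.comm_d ≫ kernel.map T.d U.d g.f₁ g.f₀ g.comm_d
      rw [← cancel_mono (kernel.ι U.d)]; simp
    · change kernel.map S.c U.c (f.f₁ ≫ g.f₁) (f.f₀' ≫ g.f₀')
        (Spn.Hom.comm_c (f ≫ g)) =
        kernel.map S.c T.c f.f₁ f.f₀' f.comm_c ≫ kernel.map T.c U.c g.f₁ g.f₀' g.comm_c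
      rw [← cancel_mono (kernel.ι U.c)]; simp
    · rfl

lemma gamma_left (S : Spn C) :
    coprod.desc (𝟙 _) (kernel.ι S.d) ≫ S.d = retr S.S₁ (kernel S.d) ≫ S.d := by
  ext <;> simp

lemma gamma_right (S : Spn C) :
    coprod.desc (𝟙 _) (kernel.ι S.c) ≫ S.c = retr S.S₁ (kernel S.c) ≫ S.c := by
  ext <;> simp

/-- The morphism `γ = ⟨[1, ker d]π₁, [1, 0]π₁, [1, ker c]π₂⟩` from
`(S₁ + Ker d) ×_{S₁} (S₁ + Ker c)` to `S₁ ×_{S₀} S₁ ×_{S₀'} S₁`. -/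
def gamma (S : Spn C) : wprod S.S₁ (kernel S.d) (kernel S.c) ⟶ S.triple :=
  S.tripleLift (pullback.fst _ _ ≫ coprod.desc (𝟙 _) (kernel.ι S.d))
    (pullback.fst _ _ ≫ retr S.S₁ (kernel S.d))
    (pullback.snd _ _ ≫ coprod.desc (𝟙 _) (kernel.ι S.c))
    (by rw [Category.assoc, gamma_left, Category.assoc])
    (by rw [pullback.condition, Category.assoc, ← gamma_right, Category.assoc])

lemma isInternalMultiplication_gamma (P : Pgrd C) :
    IsInternalMultiplication (kernel.ι P.toSpn.d) (kernel.ι P.toSpn.c) (𝟙 P.toSpn.S₁)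
      (gamma P.toSpn ≫ P.p) where
  left := by
    rw [← Category.assoc, gamma, Spn.comp_tripleLift]
    rw [Spn.tripleLift_congr P.toSpn (a' := coprod.desc (𝟙 _) (kernel.ι P.toSpn.d))
      (b' := retr _ _) (e' := retr _ _), Pgrd.p_abb]
    · rw [wprodLeft, pullback.lift_fst_assoc, Category.id_comp]
    · rw [wprodLeft, pullback.lift_fst_assoc, Category.id_comp]
    · rw [wprodLeft, pullback.lift_snd_assoc, Category.assoc, coprod.inl_desc, Category.comp_id]
  right := by
    rw [← Category.assoc, gamma, Spn.comp_tripleLift]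
    rw [Spn.tripleLift_congr P.toSpn (a' := retr _ _) (b' := retr _ _)
      (e' := coprod.desc (𝟙 _) (kernel.ι P.toSpn.c)), Pgrd.p_aab]
    · rw [wprodRight, pullback.lift_fst_assoc, Category.assoc, coprod.inl_desc, Category.comp_id]
    · rw [wprodRight, pullback.lift_fst_assoc, Category.assoc, coprod.inl_desc, Category.comp_id]
    · rw [wprodRight, pullback.lift_snd_assoc, Category.id_comp]

lemma gamma_naturality {S T : Spn C} (f : S ⟶ T) :
    gamma S ≫ Spn.tripleMap f =
      wprodMap f.f₁ (kernel.map S.d T.d f.f₁ f.f₀ f.comm_d)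
        (kernel.map S.c T.c f.f₁ f.f₀' f.comm_c) ≫ gamma T := by
  rw [gamma, Spn.tripleLift_tripleMap, gamma, Spn.comp_tripleLift]
  apply Spn.tripleLift_congr
  · simp [wprodMap, pullback.map, pullback.lift_fst_assoc]
  · simp [wprodMap, pullback.map, pullback.lift_fst_assoc]
  · simp [wprodMap, pullback.map, pullback.lift_snd_assoc]

/-- The functor from pregroupoids to multiplicative weighted cospans lying over `kernelCospan`;
a pregroupoid operation `p` is sent to the internal multiplication `p ∘ γ`. -/
def pgrdToMWCospan (C : Type u) [Category.{v} C] [HasZeroMorphisms C] [HasBinaryCoproducts C]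
    [HasPullbacks C] [HasKernels C] : Pgrd C ⥤ MWCospan C where
  obj P := ⟨(kernelCospan C).obj P.toSpn, gamma P.toSpn ≫ P.p, isInternalMultiplication_gamma P⟩
  map {P Q} f :=
    { toWHom := (kernelCospan C).map f.toSpnHom
      comm_m := by
        change (gamma P.toSpn ≫ P.p) ≫ f.toSpnHom.f₁ =
          wprodMap f.toSpnHom.f₁ (kernel.map _ _ f.toSpnHom.f₁ f.toSpnHom.f₀ f.toSpnHom.comm_d)
            (kernel.map _ _ f.toSpnHom.f₁ f.toSpnHom.f₀' f.toSpnHom.comm_c) ≫ gamma Q.toSpn ≫ Q.p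
        rw [Category.assoc, f.comm_p, ← Category.assoc, gamma_naturality, Category.assoc] }
  map_id P := by
    apply MWCospan.Hom.ext
    exact (kernelCospan C).map_id P.toSpn
  map_comp f g := by
    apply MWCospan.Hom.ext
    exact (kernelCospan C).map_comp f.toSpnHom g.toSpnHom

/-! ### The full subcategories given by normal epimorphisms and normal monomorphisms -/

/-- Spans whose two legs are normal epimorphisms. -/
def nEpiSpn (C : Type u) [Category.{v} C] [HasZeroMorphisms C] : ObjectProperty (Spn C) :=
  fun S => IsNormalEpi S.d ∧ IsNormalEpi S.c

/-- Pregroupoids whose two legs are normal epimorphisms. -/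
def nEpiPgrd (C : Type u) [Category.{v} C] [HasZeroMorphisms C] [HasPullbacks C] :
    ObjectProperty (Pgrd C) :=
  fun P => IsNormalEpi P.toSpn.d ∧ IsNormalEpi P.toSpn.c

/-- `1`-weighted cospans with `x` and `y` normal monomorphisms (the weight `1_A` always is one). -/
def nMonoCospan (C : Type u) [Category.{v} C] [HasZeroMorphisms C] :
    ObjectProperty (WCospan C) :=
  fun S => S.IsOneWeighted ∧ IsNormalMono S.x ∧ IsNormalMono S.y

/-- Multiplicative `1`-weighted cospans with `x` and `y` normal monomorphisms. -/
def nMonoMCospan (C : Type u) [Category.{v} C] [HasZeroMorphisms C] [HasBinaryCoproducts C]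
    [HasPullbacks C] : ObjectProperty (MWCospan C) :=
  fun S => S.toWCospan.IsOneWeighted ∧ IsNormalMono S.toWCospan.x ∧ IsNormalMono S.toWCospan.y

/-- The functor `NEpiS(C) ⥤ NMonoCS₁(C)` induced by `kernelCospan`. -/
def nEpiSpnToNMonoCospan (C : Type u) [Category.{v} C] [HasZeroMorphisms C] [HasKernels C] :
    (nEpiSpn C).FullSubcategory ⥤ (nMonoCospan C).FullSubcategory :=
  (nMonoCospan C).lift ((nEpiSpn C).ι ⋙ kernelCospan C) fun S =>
    ⟨⟨_, _, _, _, _, rfl⟩, isNormalMono_kernel_ι S.obj.d, isNormalMono_kernel_ι S.obj.c⟩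

/-- The functor `NEpiPgrd(C) ⥤ NMonoMCS₁(C)` induced by `pgrdToMWCospan`. -/
def nEpiPgrdToNMonoMCospan (C : Type u) [Category.{v} C] [HasZeroMorphisms C]
    [HasBinaryCoproducts C] [HasPullbacks C] [HasKernels C] :
    (nEpiPgrd C).FullSubcategory ⥤ (nMonoMCospan C).FullSubcategory :=
  (nMonoMCospan C).lift ((nEpiPgrd C).ι ⋙ pgrdToMWCospan C) fun P =>
    ⟨⟨_, _, _, _, _, rfl⟩, isNormalMono_kernel_ι P.obj.toSpn.d, isNormalMono_kernel_ι P.obj.toSpn.c⟩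

end MCS

/-! ### Equivalence relations and the Pedicchio commutator -/

/-- An internal equivalence relation on `A`. -/
structure EqRel (A : C) where
  R : C
  fst : R ⟶ A
  snd : R ⟶ A
  isEquivalenceRelation : IsEquivalenceRelation fst snd

namespace EqRel

variable {A : C}

/-- Two equivalence relations on `A` are the same, i.e. isomorphic over `A`. -/
def Same (D E : EqRel A) : Prop :=
  ∃ e : D.R ≅ E.R, e.hom ≫ E.fst = D.fst ∧ e.hom ≫ E.snd = D.snd

/-- The kernel pair of a morphism. -/
def kernelPair [HasPullbacks C] {B : C} (f : A ⟶ B) : EqRel A where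
  R := pullback f f
  fst := pullback.fst f f
  snd := pullback.snd f f
  isEquivalenceRelation :=
    (IsKernelPair.equivalenceRelation f _ _ (pullbackIsPullback _ _)
      (IsKernelPair.of_hasPullback f)).isEquivalenceRelation

/-- The equivalence relation `A ×_{A/X} A` corresponding to a (normal) monomorphism `x : X ⟶ A`:
the kernel pair of the cokernel of `x`. -/
def ofMono [HasZeroMorphisms C] [HasPullbacks C] [HasCokernels C] {X : C} (x : X ⟶ A) : EqRel A :=
  kernelPair (cokernel.π x)

variable [HasCoequalizers C]

/-- The quotient morphism `A ⟶ A/E`. -/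
def proj (E : EqRel A) : A ⟶ coequalizer E.fst E.snd := coequalizer.π _ _

/-- The normal monomorphism corresponding to `E`: the kernel of the quotient morphism. -/
def normalMono [HasZeroMorphisms C] [HasKernels C] (E : EqRel A) : kernel E.proj ⟶ A :=
  kernel.ι _

instance [HasZeroMorphisms C] [HasKernels C] (E : EqRel A) : Mono E.normalMono := by
  unfold normalMono; infer_instance

/-- The span `A/E ⟵ A ⟶ A/E'`. -/
def quotientSpn (E E' : EqRel A) : Spn C := ⟨A, _, _, E.proj, E'.proj⟩

/-- `D` is the Pedicchio commutator `[E, E']`: the reflection `F(A/E ⟵ A ⟶ A/E')` of the span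
`A/E ⟵ A ⟶ A/E'` into pregroupoids, i.e. the value of the left adjoint `F` of the forgetful
functor from pregroupoids to spans, exists, and `D` is the kernel pair of the component of the
reflection morphism (the unit) at `A`. -/
def IsPedicchioCommutator [HasPullbacks C] (E E' D : EqRel A) : Prop :=
  ∃ F : StructuredArrow (E.quotientSpn E') (Pgrd.forget C), Nonempty F.IsUniversal ∧
    IsKernelPair (Spn.Hom.f₁ F.hom) D.fst D.snd

end EqRel

end WeightedCommutator

end

/-! Protomodularity enters as a generation principle: in a split epimorphism, a subobject containing
the section and the kernel is everything. Consequently triples `(a, b, e)` are generated by the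
degenerate ones `(a, b, b)` and `(a, a, b)`, both `q = canonicalMap` and `γ = gamma` are strong
epimorphisms, and every strong epimorphism is the cokernel of its kernel, so a morphism descends
along it once it kills the kernel.

Since `q` is epic, an internal multiplication is just a factorisation of `[w, x, y]` through `q`.
For a span with middle object `S₁` and a morphism `ν : S₁ ⟶ B`, call `p : S₃ ⟶ B` a partial Mal'tsev
operation along `ν` if `p(a, b, b) = ν a` and `p(a, a, b) = ν b`. Composition with `γ` identifies
these with multiplications along `ν`; descent works because each element of the kernel of `γ` splits
into a part in `S₁ + Ker d` and a part in `S₁ + Ker c`, on which the multiplication is prescribed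
and vanishes (`exists_desc_gamma`). The case `ν = 1` gives the two equivalences, normal
monomorphisms being the kernels of their cokernels.

For (a) and (b), the pushout defining `ν` makes it universal among morphisms along which a
multiplication, hence a partial Mal'tsev operation, exists. To obtain a pregroupoid on its codomain,
the span is replaced by its direct image along `ν`. Reflexive relations are equivalence relations
and these are effective, so direct images of kernel pairs are kernel pairs
(`strongEpi_kernelPair_map`); the operation then descends to the direct image, which is the
reflection. The Pedicchio commutator is therefore the kernel pair of `ν`.

For (c), `[1, x, y]` is a split epimorphism, and the direct image of the kernel of `q` along it is
again a kernel, namely that of `ν`. -/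

noncomputable section

namespace WeightedCommutator

/-! ### Split epimorphisms are generated by section and kernel. -/

section Protomodular

variable {C : Type u} [Category.{v} C] [HasZeroMorphisms C] [SemiAbelian C]

/-- A subobject of `T` containing a section and the kernel of a split epimorphism is everything. -/
lemma isIso_of_section_of_kernel {T B M : C} (p : T ⟶ B) (s : B ⟶ T) (hs : s ≫ p = 𝟙 B)
    (j : M ⟶ T) [Mono j] (s' : B ⟶ M) (hs' : s' ≫ j = s) (k : kernel p ⟶ M)
    (hk : k ≫ j = kernel.ι p) : IsIso j := by
  have hs'p : s' ≫ j ≫ p = 𝟙 B := by rw [← Category.assoc, hs', hs]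
  -- The Split Short Five Lemma over `𝟙 B`: since `M` contains `ker p`, the split epimorphisms `j ≫
  -- p` and `p` have the same kernel.
  refine SemiAbelian.split_short_five (j ≫ p) s' p s j (𝟙 B) hs'p hs (by simp [hs'])
    (by simp) ?_ inferInstance
  refine ⟨kernel.lift _ k (by rw [← Category.assoc, hk, kernel.condition]), ?_, ?_⟩
  · rw [← cancel_mono (kernel.ι (j ≫ p)), ← cancel_mono j]
    simp [hk]
  · rw [← cancel_mono (kernel.ι p)]
    simp [hk]

/-- If `g` factors through the monomorphism `j` on a section and on the kernel of a split
epimorphism, then it factors through `j`. -/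
lemma exists_factor_of_section_of_kernel {T B M Z : C} (p : T ⟶ B) (s : B ⟶ T) (hs : s ≫ p = 𝟙 B)
    (g : T ⟶ Z) (j : M ⟶ Z) [Mono j] (a : B ⟶ M) (ha : a ≫ j = s ≫ g) (k : kernel p ⟶ M)
    (hk : k ≫ j = kernel.ι p ≫ g) : ∃ l : T ⟶ M, l ≫ j = g := by
  -- The inverse image of `M` along `g` contains the section and the kernel, so it is all of `T`.
  have := isIso_of_section_of_kernel p s hs (pullback.snd j g)
    (pullback.lift a s ha) (by simp [pullback.lift_snd])
    (pullback.lift k (kernel.ι p) hk) (by simp [pullback.lift_snd])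
  exact ⟨inv (pullback.snd j g) ≫ pullback.fst j g, by
    rw [Category.assoc, pullback.condition, IsIso.inv_hom_id_assoc]⟩

/-- A section and the kernel of a split epimorphism are jointly epimorphic. -/
lemma hom_ext_of_section_of_kernel {T B Z : C} (p : T ⟶ B) (s : B ⟶ T) (hs : s ≫ p = 𝟙 B)
    {f g : T ⟶ Z} (h : s ≫ f = s ≫ g) (hk : kernel.ι p ≫ f = kernel.ι p ≫ g) : f = g := by
  obtain ⟨l, hl⟩ := exists_factor_of_section_of_kernel p s hs (𝟙 T) (equalizer.ι f g)
    (equalizer.lift s h) (by simp) (equalizer.lift _ hk) (by simp)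
  rw [← Category.id_comp f, ← hl, Category.assoc, equalizer.condition, ← Category.assoc, hl,
    Category.id_comp]

lemma strongEpi_of_forall_mono {X Y : C} (f : X ⟶ Y)
    (hf : ∀ ⦃Z : C⦄ (p : X ⟶ Z) (i : Z ⟶ Y) (_ : p ≫ i = f) [Mono i], IsIso i) :
    StrongEpi f :=
  (extremalEpi_iff_strongEpi_of_hasPullbacks f).1 (ExtremalEpi.mk_of_hasEqualizers f hf)

omit [HasZeroMorphisms C] [SemiAbelian C] in
lemma exists_factor_of_strongEpi {X Y Z M : C} (e : X ⟶ Y) [StrongEpi e] (j : M ⟶ Z) [Mono j]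
    (a : X ⟶ M) (g : Y ⟶ Z) (h : a ≫ j = e ≫ g) : ∃ l : Y ⟶ M, l ≫ j = g :=
  have sq : CommSq a e j g := ⟨h⟩
  ⟨sq.lift, sq.fac_right⟩

/-- In a semi-abelian category a strong epimorphism is the cokernel of its kernel. -/
lemma exists_desc_of_strongEpi {X Y Z : C} (f : X ⟶ Y) [StrongEpi f] (g : X ⟶ Z)
    (h : kernel.ι f ≫ g = 0) : ∃ l : Y ⟶ Z, f ≫ l = g := by
  -- The kernel pair of `f` is generated by the diagonal and the pairs `(k, 0)` with `k` in the
  -- kernel of `f`; `g` identifies the components of both.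
  have key : pullback.fst f f ≫ g = pullback.snd f f ≫ g := by
    refine hom_ext_of_section_of_kernel (pullback.snd f f) (pullback.lift (𝟙 X) (𝟙 X) rfl)
      (by simp [pullback.lift_snd]) ?_ ?_
    · rw [← Category.assoc, ← Category.assoc, pullback.lift_fst, pullback.lift_snd]
    · have h1 : kernel.ι (pullback.snd f f) ≫ pullback.fst f f =
          kernel.lift f (kernel.ι (pullback.snd f f) ≫ pullback.fst f f)
            (by rw [Category.assoc, pullback.condition, kernel.condition_assoc, zero_comp]) ≫
          kernel.ι f := by simp
      rw [kernel.condition_assoc, zero_comp, ← Category.assoc, h1, Category.assoc, h, comp_zero]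
  have hf : IsRegularEpi f := inferInstance
  exact ⟨_, Cofork.IsColimit.π_desc' (IsKernelPair.toCoequalizer' (IsKernelPair.of_hasPullback f))
    g key⟩

/-- The product of two split epimorphisms over `B` is generated by its two factors. -/
lemma exists_factor_of_pullback {P Q B Z M : C} (p : P ⟶ B) (s : B ⟶ P) (hs : s ≫ p = 𝟙 B)
    (q : Q ⟶ B) (t : B ⟶ Q) (ht : t ≫ q = 𝟙 B) (g : pullback p q ⟶ Z) (j : M ⟶ Z) [Mono j]
    (a : P ⟶ M) (ha : a ≫ j = pullback.lift (𝟙 P) (p ≫ t) (by simp [ht]) ≫ g)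
    (b : Q ⟶ M) (hb : b ≫ j = pullback.lift (q ≫ s) (𝟙 Q) (by simp [hs]) ≫ g) :
    ∃ l : pullback p q ⟶ M, l ≫ j = g := by
  refine exists_factor_of_section_of_kernel (pullback.snd p q)
    (pullback.lift (q ≫ s) (𝟙 Q) (by simp [hs])) (by simp [pullback.lift_snd]) g j b hb
    (kernel.ι (pullback.snd p q) ≫ pullback.fst p q ≫ a) ?_
  simp only [Category.assoc, ha]
  simp only [← Category.assoc]
  congr 1
  apply pullback.hom_ext
  · simp [pullback.lift_fst]
  · simp [pullback.lift_snd, pullback.condition_assoc]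

end Protomodular

/-! ### Generation of triples, and reflexive relations. -/

section Triple

variable {C : Type u} [Category.{v} C] [HasZeroMorphisms C] [SemiAbelian C]

namespace Spn

/-- The morphism `(a, b) ↦ (a, b, b)`. -/
def abb (S : Spn C) : pullback S.d S.d ⟶ S.triple :=
  S.tripleLift (pullback.fst S.d S.d) (pullback.snd S.d S.d) (pullback.snd S.d S.d)
    pullback.condition rfl

/-- The morphism `(a, b) ↦ (a, a, b)`. -/
def aab (S : Spn C) : pullback S.c S.c ⟶ S.triple :=
  S.tripleLift (pullback.fst S.c S.c) (pullback.fst S.c S.c) (pullback.snd S.c S.c)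
    rfl pullback.condition

/-- The object of triples is generated by the triples `(a, b, b)` and `(a, a, b)`. -/
lemma exists_factor_of_triple (S : Spn C) {Z M : C} (g : S.triple ⟶ Z) (j : M ⟶ Z) [Mono j]
    (a : pullback S.d S.d ⟶ M) (ha : a ≫ j = S.abb ≫ g)
    (b : pullback S.c S.c ⟶ M) (hb : b ≫ j = S.aab ≫ g) : ∃ l : S.triple ⟶ M, l ≫ j = g := by
  refine exists_factor_of_pullback (pullback.snd S.d S.d) (pullback.lift (𝟙 _) (𝟙 _) rfl)
    (by simp [pullback.lift_snd]) (pullback.fst S.c S.c) (pullback.lift (𝟙 _) (𝟙 _) rfl)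
    (by simp [pullback.lift_fst]) g j a ?_ b ?_
  · rw [ha]
    congr 1
    apply triple_hom_ext <;> simp [abb, tripleLift_pr₁, tripleLift_pr₂, tripleLift_pr₃] <;>
      simp [pr₁, pr₂, pr₃, pullback.lift_fst_assoc, pullback.lift_snd_assoc, pullback.lift_snd]
  · rw [hb]
    congr 1
    apply triple_hom_ext <;> simp [aab, tripleLift_pr₁, tripleLift_pr₂, tripleLift_pr₃] <;>
      simp [pr₁, pr₂, pr₃, pullback.lift_fst_assoc, pullback.lift_snd_assoc, pullback.lift_fst,
        pullback.lift_snd]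

/-- The equalizer contains the generating triples. Partial Mal'tsev operations are therefore unique,
and equations between them need only be tested on degenerate triples. -/
lemma triple_hom_ext_of_abb_of_aab (S : Spn C) {Z : C} {f g : S.triple ⟶ Z}
    (h : S.abb ≫ f = S.abb ≫ g) (h' : S.aab ≫ f = S.aab ≫ g) : f = g := by
  obtain ⟨l, hl⟩ := S.exists_factor_of_triple (𝟙 _) (equalizer.ι f g)
    (equalizer.lift _ h) (by simp) (equalizer.lift _ h') (by simp)
  rw [← Category.id_comp f, ← hl, Category.assoc, equalizer.condition, ← Category.assoc, hl,
    Category.id_comp]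

end Spn

/-- In a semi-abelian category a reflexive relation is an equivalence relation. -/
lemma isEquivalenceRelation_of_reflexive {R A : C} (r₁ r₂ : R ⟶ A)
    (hm : ∀ ⦃T : C⦄ (f g : T ⟶ R), f ≫ r₁ = g ≫ r₁ → f ≫ r₂ = g ≫ r₂ → f = g)
    (r : A ⟶ R) (hr₁ : r ≫ r₁ = 𝟙 A) (hr₂ : r ≫ r₂ = 𝟙 A) : IsEquivalenceRelation r₁ r₂ := by
  -- The legs are crossed so that triples `(x, y, z)` satisfy `r₂ x = r₂ y` and `r₁ y = r₁ z`. The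
  -- factorisation `ρ` is difunctionality, `(r₁ x, r₂ z) ∈ R`; on the triples `(x, y, y)` and `(x,
  -- x, z)` it is witnessed by `x` and `z`.
  let S : Spn C := ⟨R, A, A, r₂, r₁⟩
  have : Mono (prod.lift r₁ r₂) := ⟨fun f g h => hm f g
    (by simpa only [Category.assoc, prod.lift_fst] using congrArg (· ≫ prod.fst) h)
    (by simpa only [Category.assoc, prod.lift_snd] using congrArg (· ≫ prod.snd) h)⟩
  obtain ⟨ρ, hρ⟩ := S.exists_factor_of_triple (prod.lift (S.pr₁ ≫ r₁) (S.pr₃ ≫ r₂))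
    (prod.lift r₁ r₂) (pullback.fst r₂ r₂)
    (by
      apply Limits.prod.hom_ext
      · simp only [Category.assoc, prod.lift_fst]
        rw [← Category.assoc, Spn.abb, Spn.tripleLift_pr₁]
      · simp only [Category.assoc, prod.lift_snd]
        rw [← Category.assoc, Spn.abb, Spn.tripleLift_pr₃]
        exact pullback.condition)
    (pullback.snd r₁ r₁)
    (by
      apply Limits.prod.hom_ext
      · simp only [Category.assoc, prod.lift_fst]
        rw [← Category.assoc, Spn.aab, Spn.tripleLift_pr₁]
        exact pullback.condition.symm
      · simp only [Category.assoc, prod.lift_snd]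
        rw [← Category.assoc, Spn.aab, Spn.tripleLift_pr₃])
  have hρ₁ : ρ ≫ r₁ = S.pr₁ ≫ r₁ := by
    simpa only [Category.assoc, prod.lift_fst] using congrArg (· ≫ prod.fst) hρ
  have hρ₂ : ρ ≫ r₂ = S.pr₃ ≫ r₂ := by
    simpa only [Category.assoc, prod.lift_snd] using congrArg (· ≫ prod.snd) hρ
  have dif : ∀ {T : C} (x y z : T ⟶ R), x ≫ r₂ = y ≫ r₂ → y ≫ r₁ = z ≫ r₁ →
      ∃ w : T ⟶ R, w ≫ r₁ = x ≫ r₁ ∧ w ≫ r₂ = z ≫ r₂ := fun x y z h h' =>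
    ⟨S.tripleLift x y z h h' ≫ ρ,
      by rw [Category.assoc, hρ₁, ← Category.assoc, Spn.tripleLift_pr₁],
      by rw [Category.assoc, hρ₂, ← Category.assoc, Spn.tripleLift_pr₃]⟩
  -- Symmetry comes from the triple `(b, b), (a, b), (a, a)`; transitivity from `(a, b), (b, b), (b,
  -- c)`.
  obtain ⟨σ, hσ₁, hσ₂⟩ := dif (r₂ ≫ r) (𝟙 R) (r₁ ≫ r) (by simp [hr₂]) (by simp [hr₁])
  obtain ⟨τ, hτ₁, hτ₂⟩ := dif (pullback.fst r₂ r₁) (pullback.fst r₂ r₁ ≫ r₂ ≫ r)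
    (pullback.snd r₂ r₁) (by simp [hr₂]) (by simp [hr₁, pullback.condition])
  exact ⟨⟨{
    right_cancellation := hm
    r := r
    reflexivity₁ := hr₁
    reflexivity₂ := hr₂
    s := σ
    symmetry₁ := by simpa [hr₁] using hσ₁
    symmetry₂ := by simpa [hr₂] using hσ₂
    c := PullbackCone.mk (pullback.fst r₂ r₁) (pullback.snd r₂ r₁) pullback.condition
    isLimit := pullbackIsPullback _ _
    t := τ
    transitivity₁ := hτ₁
    transitivity₂ := hτ₂ }⟩⟩

end Triple

/-! ### Direct images of kernel pairs and of kernels. -/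

section Direct

variable {C : Type u} [Category.{v} C] [HasZeroMorphisms C] [SemiAbelian C]

/-- Direct images of effective equivalence relations: if `d'` is the cokernel of `ker d ≫ ν`, with
`ν` a strong epimorphism, then the kernel pair of `d` covers the kernel pair of `d'`. -/
lemma strongEpi_kernelPair_map {A D A' D' : C} (d : A ⟶ D) (ν : A ⟶ A') [StrongEpi ν]
    (d' : A' ⟶ D') (h : D ⟶ D') (hc : d ≫ h = ν ≫ d')
    (hd' : ∀ {Z : C} (g : A' ⟶ Z), kernel.ι d ≫ ν ≫ g = 0 → ∃ l, d' ≫ l = g) :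
    StrongEpi (pullback.map d d d' d' ν ν h hc hc) := by
  set φ := pullback.map d d d' d' ν ν h hc hc with hφ
  have hφ₁ : φ ≫ pullback.fst d' d' = pullback.fst d d ≫ ν := by simp [hφ, pullback.lift_fst]
  have hφ₂ : φ ≫ pullback.snd d' d' = pullback.snd d d ≫ ν := by simp [hφ, pullback.lift_snd]
  -- The image of `φ` is a relation on `A'`, reflexive because `ν` is a strong epimorphism, hence
  -- the kernel pair of some `f`.
  let F := Regular.strongEpiMonoFactorisation φ
  let r₁ := F.m ≫ pullback.fst d' d'
  let r₂ := F.m ≫ pullback.snd d' d'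
  have her₁ : F.e ≫ r₁ = pullback.fst d d ≫ ν := by
    rw [← hφ₁, ← F.fac_assoc]
  have her₂ : F.e ≫ r₂ = pullback.snd d d ≫ ν := by
    rw [← hφ₂, ← F.fac_assoc]
  obtain ⟨r, hr⟩ := exists_factor_of_strongEpi ν F.m
    (pullback.lift (𝟙 A) (𝟙 A) rfl ≫ F.e) (pullback.lift (𝟙 A') (𝟙 A') rfl) (by
      rw [Category.assoc, F.fac]
      apply pullback.hom_ext
      · simp [hφ₁, pullback.lift_fst, pullback.lift_fst_assoc]
      · simp [hφ₂, pullback.lift_snd, pullback.lift_snd_assoc])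
  have hR : IsEquivalenceRelation r₁ r₂ := by
    refine isEquivalenceRelation_of_reflexive r₁ r₂ (fun T f g h₁ h₂ => ?_) r ?_ ?_
    · rw [← cancel_mono F.m]
      apply pullback.hom_ext
      · simpa [r₁] using h₁
      · simpa [r₂] using h₂
    · rw [← Category.assoc, hr, pullback.lift_fst]
    · rw [← Category.assoc, hr, pullback.lift_snd]
  obtain ⟨B, f, hf⟩ := SemiAbelian.effective r₁ r₂ hR
  -- The pairs `(k, 0)` with `k` in `Ker d` show that `f` kills `ker d ≫ ν`, so `f` factors through
  -- `d'`. The kernel pair of `d'` is then contained in that of `f`, which is the image of `φ`.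
  obtain ⟨l, hl⟩ := hd' f (by
    have h1 : kernel.ι d ≫ ν = (pullback.lift (kernel.ι d) 0 (by simp) ≫ F.e) ≫ r₁ := by
      rw [Category.assoc, her₁, ← Category.assoc, pullback.lift_fst]
    have h2 : 0 = (pullback.lift (kernel.ι d) 0 (by simp) ≫ F.e) ≫ r₂ := by
      rw [Category.assoc, her₂, ← Category.assoc, pullback.lift_snd, zero_comp]
    rw [← Category.assoc, h1, Category.assoc, hf.w, ← Category.assoc, ← h2, zero_comp])
  have hsec : hf.lift (pullback.fst d' d') (pullback.snd d' d')
      (by rw [← hl, pullback.condition_assoc]) ≫ F.m = 𝟙 _ := by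
    apply pullback.hom_ext
    · rw [Category.assoc, Category.id_comp]
      exact IsKernelPair.lift_fst _ _ _ _
    · rw [Category.assoc, Category.id_comp]
      exact IsKernelPair.lift_snd _ _ _ _
  have : IsSplitEpi F.m := ⟨⟨_, hsec⟩⟩
  have : IsIso F.m := isIso_of_mono_of_isSplitEpi F.m
  rw [← F.fac]
  infer_instance

/-- A strong epimorphism between split epimorphisms restricts to a strong epimorphism between
their kernels. -/
lemma strongEpi_kernel_map {R B R' A : C} (p : R ⟶ B) (s : B ⟶ R) (hs : s ≫ p = 𝟙 B)
    (p' : R' ⟶ A) (s' : A ⟶ R') (e : R ⟶ R') [StrongEpi e] (f : B ⟶ A)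
    (h : p ≫ f = e ≫ p') (hse : s ≫ e = f ≫ s') : StrongEpi (kernel.map p p' e f h) := by
  let φ : R ⟶ pullback f p' := pullback.lift p e h
  have hφ : StrongEpi φ := by
    -- Pulling back along `e` turns the projection to `R'` into a split epimorphism over `R`, with
    -- section `⟨φ, 1⟩`. Its kernel consists of the `(b, 0)` with `f b = 0`, and there `(b, 0) = φ
    -- (s b)`; so all of it lies in any subobject through which `φ` factors.
    refine strongEpi_of_forall_mono φ fun M a j haj _ => ?_
    let g := pullback.fst (pullback.snd f p') e
    have hg : IsRegularEpi g := inferInstance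
    obtain ⟨l, hl⟩ := exists_factor_of_section_of_kernel (pullback.snd (pullback.snd f p') e)
      (pullback.lift φ (𝟙 R) (by simp [φ, pullback.lift_snd])) (by simp [pullback.lift_snd])
      g j a (by rw [haj, pullback.lift_fst])
      (kernel.ι (pullback.snd (pullback.snd f p') e) ≫ g ≫ pullback.fst f p' ≫ s ≫ a) (by
        have hz : kernel.ι (pullback.snd (pullback.snd f p') e) ≫ g ≫ pullback.snd f p' = 0 := by
          rw [pullback.condition, kernel.condition_assoc, zero_comp]
        simp only [Category.assoc, haj]
        apply pullback.hom_ext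
        · simp only [Category.assoc, φ, pullback.lift_fst, hs, Category.comp_id]
        · simp only [Category.assoc, φ, pullback.lift_snd, hse, hz]
          rw [pullback.condition_assoc, ← Category.assoc g, ← Category.assoc (kernel.ι _), hz,
            zero_comp])
    have : StrongEpi (l ≫ j) := hl ▸ inferInstance
    have : StrongEpi j := strongEpi_of_strongEpi l j
    exact isIso_of_mono_of_strongEpi j
  -- Over the elements `(0, r')` of the pullback, `φ` restricts to a regular epimorphism from a part
  -- of `R` killed by `p`.
  let κ : kernel p' ⟶ pullback f p' := pullback.lift 0 (kernel.ι p') (by simp)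
  have hreg : IsRegularEpi (pullback.snd φ κ) := inferInstance
  have hz : pullback.fst φ κ ≫ p = 0 := by
    have := congrArg (· ≫ pullback.fst f p') (pullback.condition (f := φ) (g := κ))
    simpa only [φ, κ, Category.assoc, pullback.lift_fst, comp_zero] using this
  have hfac : kernel.lift p (pullback.fst φ κ) hz ≫ kernel.map p p' e f h = pullback.snd φ κ := by
    rw [← cancel_mono (kernel.ι p')]
    have := congrArg (· ≫ pullback.snd f p') (pullback.condition (f := φ) (g := κ))
    simp only [φ, κ, Category.assoc, pullback.lift_snd] at this
    simp only [Category.assoc, kernel.lift_ι, kernel.map, kernel.lift_ι_assoc]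
    exact this
  have : StrongEpi (kernel.lift p (pullback.fst φ κ) hz ≫ kernel.map p p' e f h) :=
    hfac ▸ inferInstance
  exact strongEpi_of_strongEpi (kernel.lift p (pullback.fst φ κ) hz) _

/-- The direct image of a kernel along a strong epimorphism is normal: if `d'` is the cokernel of
`ker d ≫ ν`, then `ker d` covers `ker d'`. -/
lemma strongEpi_kernel_map_of_cokernel {A D A' D' : C} (d : A ⟶ D) (ν : A ⟶ A') [StrongEpi ν]
    (d' : A' ⟶ D') (h : D ⟶ D') (hc : d ≫ h = ν ≫ d')
    (hd' : ∀ {Z : C} (g : A' ⟶ Z), kernel.ι d ≫ ν ≫ g = 0 → ∃ l, d' ≫ l = g) :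
    StrongEpi (kernel.map d d' ν h hc) := by
  have := strongEpi_kernelPair_map d ν d' h hc hd'
  have hcomm : pullback.snd d d ≫ ν =
      pullback.map d d d' d' ν ν h hc hc ≫ pullback.snd d' d' := by simp [pullback.lift_snd]
  have hk := strongEpi_kernel_map (pullback.snd d d) (pullback.lift (𝟙 A) (𝟙 A) rfl)
    (by simp [pullback.lift_snd]) (pullback.snd d' d') (pullback.lift (𝟙 A') (𝟙 A') rfl)
    (pullback.map d d d' d' ν ν h hc hc) ν hcomm
    (by apply pullback.hom_ext <;> simp [pullback.lift_fst, pullback.lift_snd,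
      pullback.lift_fst_assoc, pullback.lift_snd_assoc])
  -- The kernel of the second projection of a kernel pair is the kernel of the morphism itself; `hk`
  -- is transported along this identification.
  refine strongEpi_of_forall_mono _ fun M a j haj _ => ?_
  obtain ⟨l, hl⟩ := exists_factor_of_strongEpi (kernel.map (pullback.snd d d) (pullback.snd d' d')
      (pullback.map d d d' d' ν ν h hc hc) ν hcomm) j
    (kernel.lift d (kernel.ι (pullback.snd d d) ≫ pullback.fst d d)
      (by rw [Category.assoc, pullback.condition, kernel.condition_assoc, zero_comp]) ≫ a)
    (kernel.lift d' (kernel.ι (pullback.snd d' d') ≫ pullback.fst d' d')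
      (by rw [Category.assoc, pullback.condition, kernel.condition_assoc, zero_comp]))
    (by
      rw [← cancel_mono (kernel.ι d')]
      simp [haj, pullback.lift_fst])
  have : IsSplitEpi j := ⟨⟨kernel.lift (pullback.snd d' d')
    (pullback.lift (kernel.ι d') 0 (by simp)) (by simp [pullback.lift_snd]) ≫ l, by
      rw [Category.assoc, hl, ← cancel_mono (kernel.ι d')]
      simp [pullback.lift_fst]⟩⟩
  exact isIso_of_mono_of_isSplitEpi j

end Direct

/-! ### The canonical morphism `q`, the morphism `γ`, and descent along them. -/

section Gamma

variable {C : Type u} [Category.{v} C] [HasZeroMorphisms C] [SemiAbelian C]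

lemma exists_factor_of_wprod {W X Y Z M : C} (g : wprod W X Y ⟶ Z) (j : M ⟶ Z) [Mono j]
    (a : W ⨿ X ⟶ M) (ha : a ≫ j = wprodLeft W X Y ≫ g)
    (b : W ⨿ Y ⟶ M) (hb : b ≫ j = wprodRight W X Y ≫ g) : ∃ l : wprod W X Y ⟶ M, l ≫ j = g :=
  exists_factor_of_pullback (retr W X) coprod.inl (inl_retr W X) (retr W Y) coprod.inl
    (inl_retr W Y) g j a ha b hb

omit [SemiAbelian C] in
lemma inl_canonicalMap [HasBinaryCoproducts C] [HasPullbacks C] (W X Y : C) :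
    coprod.inl ≫ canonicalMap W X Y = wprodLeft W X Y := by
  apply pullback.hom_ext
  · rw [Category.assoc, canonicalMap, wprodLeft, pullback.lift_fst, pullback.lift_fst]
    apply coprod.hom_ext <;>
      simp [coprod.inl_desc]
  · rw [Category.assoc, canonicalMap, wprodLeft, pullback.lift_snd, pullback.lift_snd]
    apply coprod.hom_ext <;>
      simp [coprod.inl_desc, coprod.inr_desc]

omit [SemiAbelian C] in
lemma map_canonicalMap [HasBinaryCoproducts C] [HasPullbacks C] (W X Y : C) :
    coprod.desc (coprod.inl ≫ coprod.inl) coprod.inr ≫ canonicalMap W X Y = wprodRight W X Y := by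
  apply pullback.hom_ext
  · rw [Category.assoc, canonicalMap, wprodRight, pullback.lift_fst, pullback.lift_fst]
    apply coprod.hom_ext <;>
      simp [coprod.inl_desc, coprod.inr_desc]
  · rw [Category.assoc, canonicalMap, wprodRight, pullback.lift_snd, pullback.lift_snd]
    apply coprod.hom_ext <;>
      simp [coprod.inl_desc, coprod.inr_desc]

/-- The canonical morphism `W + X + Y ⟶ (W + X) ×_W (W + Y)` is a strong epimorphism. -/
instance strongEpi_canonicalMap (W X Y : C) : StrongEpi (canonicalMap W X Y) := by
  refine strongEpi_of_forall_mono _ fun M a j haj _ => ?_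
  obtain ⟨l, hl⟩ := exists_factor_of_wprod (𝟙 (wprod W X Y)) j (coprod.inl ≫ a)
    (by rw [Category.assoc, haj, inl_canonicalMap, Category.comp_id])
    (coprod.desc (coprod.inl ≫ coprod.inl) coprod.inr ≫ a)
    (by rw [Category.assoc, haj, map_canonicalMap, Category.comp_id])
  have : IsSplitEpi j := ⟨⟨l, hl⟩⟩
  exact isIso_of_mono_of_isSplitEpi j

/-- A morphism `m` is an internal multiplication if and only if its composite with the canonical
morphism is `[w, x, y]`. -/
lemma isInternalMultiplication_iff {A X Y W : C} (x : X ⟶ A) (y : Y ⟶ A) (w : W ⟶ A)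
    (m : wprod W X Y ⟶ A) :
    IsInternalMultiplication x y w m ↔ canonicalMap W X Y ≫ m = copair x y w := by
  refine ⟨fun h => ?_, fun h => ⟨?_, ?_⟩⟩
  · apply coprod.hom_ext
    · rw [← Category.assoc, inl_canonicalMap, h.left, coprod.inl_desc]
    · have := congrArg (coprod.inr ≫ ·) h.right
      rw [← map_canonicalMap] at this
      simpa only [coprod.inr_desc, coprod.inr_desc_assoc, Category.assoc] using this
  · rw [← inl_canonicalMap, Category.assoc, h, coprod.inl_desc]
  · rw [← map_canonicalMap, Category.assoc, h]
    apply coprod.hom_ext <;>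
      simp only [coprod.desc_comp, coprod.inl_desc, coprod.inr_desc, Category.assoc]

/-- The morphism `[⟨1, 1⟩, ⟨ker d, 0⟩]` from `A + Ker d` to the kernel pair of `d`. -/
def toKernelPair {A D : C} (d : A ⟶ D) : A ⨿ kernel d ⟶ pullback d d :=
  pullback.lift (coprod.desc (𝟙 A) (kernel.ι d)) (retr A (kernel d)) (by ext <;> simp)

lemma toKernelPair_fst {A D : C} (d : A ⟶ D) :
    toKernelPair d ≫ pullback.fst d d = coprod.desc (𝟙 A) (kernel.ι d) := pullback.lift_fst _ _ _

/-- The two summands supply the diagonal and the kernel of the second projection, which generate the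
kernel pair. -/
instance strongEpi_toKernelPair {A D : C} (d : A ⟶ D) : StrongEpi (toKernelPair d) := by
  refine strongEpi_of_forall_mono _ fun M a j haj _ => ?_
  refine isIso_of_section_of_kernel (pullback.snd d d) (pullback.lift (𝟙 A) (𝟙 A) rfl)
    (by simp [pullback.lift_snd]) j (coprod.inl ≫ a) ?_
    (kernel.lift d (kernel.ι (pullback.snd d d) ≫ pullback.fst d d)
      (by rw [Category.assoc, pullback.condition, kernel.condition_assoc, zero_comp]) ≫
      coprod.inr ≫ a) ?_
  · rw [Category.assoc, haj]
    apply pullback.hom_ext <;> simp [toKernelPair, pullback.lift_fst, pullback.lift_snd,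
      coprod.inl_desc]
  · simp only [Category.assoc, haj]
    apply pullback.hom_ext <;> simp [toKernelPair, pullback.lift_fst, pullback.lift_snd,
      coprod.inr_desc]

/-- Exchange of the two components of a kernel pair. -/
def swap {A D : C} (d : A ⟶ D) : pullback d d ⟶ pullback d d :=
  pullback.lift (pullback.snd d d) (pullback.fst d d) pullback.condition.symm

lemma swap_swap {A D : C} (d : A ⟶ D) : swap d ≫ swap d = 𝟙 _ := by
  apply pullback.hom_ext <;> simp [swap, pullback.lift_fst, pullback.lift_snd]

instance {A D : C} (d : A ⟶ D) : IsIso (swap d) := ⟨swap d, swap_swap d, swap_swap d⟩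

lemma wprodLeft_gamma (S : Spn C) :
    wprodLeft S.S₁ (kernel S.d) (kernel S.c) ≫ gamma S = toKernelPair S.d ≫ S.abb := by
  rw [gamma, Spn.abb, Spn.comp_tripleLift, Spn.comp_tripleLift]
  apply Spn.tripleLift_congr <;>
    simp [-coprod.desc_comp, coprod.inl_desc, wprodLeft, toKernelPair, pullback.lift_fst_assoc, pullback.lift_snd_assoc,
      pullback.lift_fst, pullback.lift_snd]

/-- The exchange `swap` is needed because `toKernelPair` puts `[1, ker c]` in the first component,
whereas `(a, a, b)` needs it in the last. -/
lemma wprodRight_gamma (S : Spn C) :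
    wprodRight S.S₁ (kernel S.d) (kernel S.c) ≫ gamma S = (toKernelPair S.c ≫ swap S.c) ≫ S.aab := by
  rw [gamma, Spn.aab, Spn.comp_tripleLift, Spn.comp_tripleLift]
  apply Spn.tripleLift_congr <;>
    simp [-coprod.desc_comp, coprod.inl_desc, wprodRight, toKernelPair, swap, pullback.lift_fst_assoc, pullback.lift_snd_assoc,
      pullback.lift_fst, pullback.lift_snd]

lemma gamma_pr₁ (S : Spn C) : gamma S ≫ S.pr₁ =
    pullback.fst _ _ ≫ coprod.desc (𝟙 _) (kernel.ι S.d) := Spn.tripleLift_pr₁ _ _ _ _ _ _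

lemma gamma_pr₂ (S : Spn C) : gamma S ≫ S.pr₂ = pullback.fst _ _ ≫ retr S.S₁ (kernel S.d) :=
  Spn.tripleLift_pr₂ _ _ _ _ _ _

lemma gamma_pr₃ (S : Spn C) : gamma S ≫ S.pr₃ =
    pullback.snd _ _ ≫ coprod.desc (𝟙 _) (kernel.ι S.c) := Spn.tripleLift_pr₃ _ _ _ _ _ _

/-- On its two factors `γ` covers the triples `(a, b, b)` and `(a, a, b)`, which generate. -/
instance strongEpi_gamma (S : Spn C) : StrongEpi (gamma S) := by
  refine strongEpi_of_forall_mono _ fun M a j haj _ => ?_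
  obtain ⟨l₁, h₁⟩ := exists_factor_of_strongEpi (toKernelPair S.d) j
    (wprodLeft S.S₁ (kernel S.d) (kernel S.c) ≫ a) S.abb
    (by rw [Category.assoc, haj, wprodLeft_gamma])
  obtain ⟨l₂, h₂⟩ := exists_factor_of_strongEpi (toKernelPair S.c ≫ swap S.c) j
    (wprodRight S.S₁ (kernel S.d) (kernel S.c) ≫ a) S.aab
    (by rw [Category.assoc, haj, wprodRight_gamma])
  obtain ⟨l, hl⟩ := S.exists_factor_of_triple (𝟙 _) j l₁ (by simp [h₁]) l₂ (by simp [h₂])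
  have : IsSplitEpi j := ⟨⟨l, hl⟩⟩
  exact isIso_of_mono_of_isSplitEpi j

/-- A morphism out of `(A + Ker d) ×_A (A + Ker c)` which restricts to `[1, ker d] ≫ ν` and
`[1, ker c] ≫ ν` factors through `γ`. -/
lemma exists_desc_gamma (S : Spn C) {B : C} (ν : S.S₁ ⟶ B)
    (m : wprod S.S₁ (kernel S.d) (kernel S.c) ⟶ B)
    (hl : wprodLeft _ _ _ ≫ m = coprod.desc (𝟙 _) (kernel.ι S.d) ≫ ν)
    (hr : wprodRight _ _ _ ≫ m = coprod.desc (𝟙 _) (kernel.ι S.c) ≫ ν) :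
    ∃ p : S.triple ⟶ B, gamma S ≫ p = m ∧ S.abb ≫ p = pullback.fst S.d S.d ≫ ν ∧
      S.aab ≫ p = pullback.snd S.c S.c ≫ ν := by
  have hex : ∃ p : S.triple ⟶ B, gamma S ≫ p = m := by
    apply exists_desc_of_strongEpi
    let κ := kernel.ι (gamma S)
    let u := κ ≫ pullback.fst (retr S.S₁ (kernel S.d)) (retr S.S₁ (kernel S.c))
    let w := κ ≫ pullback.snd (retr S.S₁ (kernel S.d)) (retr S.S₁ (kernel S.c))
    have h₁ : u ≫ coprod.desc (𝟙 _) (kernel.ι S.d) = 0 := by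
      rw [Category.assoc, ← gamma_pr₁, kernel.condition_assoc, zero_comp]
    have h₂ : u ≫ retr S.S₁ (kernel S.d) = 0 := by
      rw [Category.assoc, ← gamma_pr₂, kernel.condition_assoc, zero_comp]
    have h₃ : w ≫ coprod.desc (𝟙 _) (kernel.ι S.c) = 0 := by
      rw [Category.assoc, ← gamma_pr₃, kernel.condition_assoc, zero_comp]
    have h₄ : w ≫ retr S.S₁ (kernel S.c) = 0 := by
      rw [← h₂, Category.assoc, Category.assoc, pullback.condition]
    have hww : w ≫ toKernelPair S.c = 0 := by
      apply pullback.hom_ext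
      · rw [Category.assoc, toKernelPair, pullback.lift_fst, h₃, zero_comp]
      · rw [Category.assoc, toKernelPair, pullback.lift_snd, h₄, zero_comp]
    let L := kernel (toKernelPair S.c)
    let i : L ⟶ _ := kernel.ι (toKernelPair S.c)
    have hi₁ : i ≫ coprod.desc (𝟙 _) (kernel.ι S.c) = 0 := by
      rw [← toKernelPair_fst, kernel.condition_assoc, zero_comp]
    have hiz : (i ≫ wprodRight S.S₁ (kernel S.d) (kernel S.c)) ≫ gamma S = 0 := by
      rw [Category.assoc, wprodRight_gamma, ← Category.assoc, ← Category.assoc,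
        kernel.condition, zero_comp, zero_comp]
    refine hom_ext_of_section_of_kernel (kernel.lift (toKernelPair S.c) w hww)
      (kernel.lift (gamma S) (i ≫ wprodRight _ _ _) hiz) ?_ ?_ ?_
    -- The second component `w` maps the kernel of `γ` onto that of `toKernelPair S.c`, split by
    -- `wprodRight`. On the section `m` is `[1, ker c] ≫ ν`, which vanishes there. Where `w = 0`,
    -- the element comes from `u` through `wprodLeft`, and `m` is `[1, ker d] ≫ ν`, which vanishes
    -- too.
    · rw [← cancel_mono i]
      simp [w, κ, i, wprodRight, pullback.lift_snd]
    · rw [comp_zero, kernel.lift_ι_assoc, Category.assoc, hr, ← Category.assoc, hi₁, zero_comp]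
    · set k := kernel.ι (kernel.lift (toKernelPair S.c) w hww) with hk
      have hkw : k ≫ w = 0 := by
        have := kernel.condition_assoc (kernel.lift (toKernelPair S.c) w hww) i
        rwa [kernel.lift_ι, zero_comp] at this
      have : k ≫ κ = (k ≫ u) ≫ wprodLeft S.S₁ (kernel S.d) (kernel S.c) := by
        apply pullback.hom_ext
        · simp only [Category.assoc, wprodLeft, pullback.lift_fst, Category.comp_id, u]
        · simp only [Category.assoc, wprodLeft, pullback.lift_snd]
          rw [← Category.assoc u, h₂, zero_comp, comp_zero]
          exact hkw
      rw [comp_zero, ← Category.assoc, this, Category.assoc, hl, Category.assoc,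
        ← Category.assoc u, h₁, zero_comp, comp_zero]
  obtain ⟨p, hp⟩ := hex
  refine ⟨p, hp, ?_, ?_⟩
  · rw [← cancel_epi (toKernelPair S.d), ← Category.assoc, ← wprodLeft_gamma, Category.assoc, hp,
      hl, ← Category.assoc, toKernelPair, pullback.lift_fst]
  · rw [← cancel_epi (toKernelPair S.c ≫ swap S.c), ← Category.assoc, ← wprodRight_gamma,
      Category.assoc, hp, hr]
    simp [toKernelPair, swap, pullback.lift_snd_assoc, pullback.lift_fst_assoc]

end Gamma

/-! ### The reflection of a span into pregroupoids. -/

section Reflection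

variable {C : Type u} [Category.{v} C] [HasZeroMorphisms C] [SemiAbelian C]

lemma abb_tripleMap {S T : Spn C} (u : S ⟶ T) : S.abb ≫ Spn.tripleMap u =
    pullback.map S.d S.d T.d T.d u.f₁ u.f₁ u.f₀ u.comm_d u.comm_d ≫ T.abb := by
  rw [Spn.abb, Spn.tripleLift_tripleMap, Spn.abb, Spn.comp_tripleLift]
  apply Spn.tripleLift_congr <;> simp [pullback.lift_fst, pullback.lift_snd]

lemma aab_tripleMap {S T : Spn C} (u : S ⟶ T) : S.aab ≫ Spn.tripleMap u =
    pullback.map S.c S.c T.c T.c u.f₁ u.f₁ u.f₀' u.comm_c u.comm_c ≫ T.aab := by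
  rw [Spn.aab, Spn.tripleLift_tripleMap, Spn.aab, Spn.comp_tripleLift]
  apply Spn.tripleLift_congr <;> simp [pullback.lift_fst, pullback.lift_snd]

/-- With its counterpart for `aab`, this makes `tripleMap f ≫ Q.p` a partial Mal'tsev operation
along `f.f₁`, to which a universal property can be applied. -/
lemma abb_tripleMap_p {S : Spn C} {Q : Pgrd C} (f : S ⟶ Q.toSpn) :
    S.abb ≫ Spn.tripleMap f ≫ Q.p = pullback.fst S.d S.d ≫ f.f₁ := by
  have hQ : Q.toSpn.abb ≫ Q.p = pullback.fst _ _ := Q.p_right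
  rw [← Category.assoc, abb_tripleMap, Category.assoc, hQ]
  simp [pullback.lift_fst]

lemma aab_tripleMap_p {S : Spn C} {Q : Pgrd C} (f : S ⟶ Q.toSpn) :
    S.aab ≫ Spn.tripleMap f ≫ Q.p = pullback.snd S.c S.c ≫ f.f₁ := by
  have hQ : Q.toSpn.aab ≫ Q.p = pullback.snd _ _ := Q.p_left
  rw [← Category.assoc, aab_tripleMap, Category.assoc, hQ]
  simp [pullback.lift_snd]

lemma strongEpi_tripleMap {S T : Spn C} (u : S ⟶ T)
    [StrongEpi (pullback.map S.d S.d T.d T.d u.f₁ u.f₁ u.f₀ u.comm_d u.comm_d)]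
    [StrongEpi (pullback.map S.c S.c T.c T.c u.f₁ u.f₁ u.f₀' u.comm_c u.comm_c)] :
    StrongEpi (Spn.tripleMap u) := by
  refine strongEpi_of_forall_mono _ fun M a j haj _ => ?_
  obtain ⟨l₁, h₁⟩ := exists_factor_of_strongEpi
    (pullback.map S.d S.d T.d T.d u.f₁ u.f₁ u.f₀ u.comm_d u.comm_d) j (S.abb ≫ a) T.abb
    (by rw [Category.assoc, haj, abb_tripleMap])
  obtain ⟨l₂, h₂⟩ := exists_factor_of_strongEpi
    (pullback.map S.c S.c T.c T.c u.f₁ u.f₁ u.f₀' u.comm_c u.comm_c) j (S.aab ≫ a) T.aab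
    (by rw [Category.assoc, haj, aab_tripleMap])
  obtain ⟨l, hl⟩ := T.exists_factor_of_triple (𝟙 _) j l₁ (by simp [h₁]) l₂ (by simp [h₂])
  have : IsSplitEpi j := ⟨⟨l, hl⟩⟩
  exact isIso_of_mono_of_isSplitEpi j

/-- A partial Mal'tsev operation with values in `B` along a span morphism `u` with first component
`ν` vanishes on the kernel of `tripleMap u`. -/
lemma kernel_tripleMap_comp {S T : Spn C} (u : S ⟶ T) {B : C} (ν : S.S₁ ⟶ B)
    (hν : kernel.ι u.f₁ ≫ ν = 0) (p : S.triple ⟶ B)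
    (hd : S.abb ≫ p = pullback.fst S.d S.d ≫ ν) (hc : S.aab ≫ p = pullback.snd S.c S.c ≫ ν) :
    kernel.ι (Spn.tripleMap u) ≫ p = 0 := by
  let n := kernel.ι u.f₁
  -- A triple killed by `tripleMap u` has all its entries in the kernel of `u.f₁`, so it is a triple
  -- of `N`. On the degenerate triples of `N` the operation is a value of `n ≫ ν = 0`.
  let N : Spn C := ⟨kernel u.f₁, S.S₀, S.S₀', n ≫ S.d, n ≫ S.c⟩
  let w : N ⟶ S := { f₁ := n, f₀ := 𝟙 _, f₀' := 𝟙 _, comm_d := by simp [N], comm_c := by simp [N] }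
  have hN : Spn.tripleMap w ≫ p = 0 := by
    apply Spn.triple_hom_ext_of_abb_of_aab
    · rw [← Category.assoc, abb_tripleMap, Category.assoc, hd, comp_zero, pullback.lift_fst_assoc,
        Category.assoc]
      change _ ≫ n ≫ ν = 0
      rw [hν, comp_zero]
    · rw [← Category.assoc, aab_tripleMap, Category.assoc, hc, comp_zero, pullback.lift_snd_assoc,
        Category.assoc]
      change _ ≫ n ≫ ν = 0
      rw [hν, comp_zero]
  let κ := kernel.ι (Spn.tripleMap u)
  have h₁ : (κ ≫ S.pr₁) ≫ u.f₁ = 0 := by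
    rw [Category.assoc, ← Spn.tripleLift_pr₁ T (S.pr₁ ≫ u.f₁) _ _ _ _]
    exact kernel.condition_assoc (Spn.tripleMap u) _ |>.trans zero_comp
  have h₂ : (κ ≫ S.pr₂) ≫ u.f₁ = 0 := by
    rw [Category.assoc, ← Spn.tripleLift_pr₂ T _ (S.pr₂ ≫ u.f₁) _ _ _]
    exact kernel.condition_assoc (Spn.tripleMap u) _ |>.trans zero_comp
  have h₃ : (κ ≫ S.pr₃) ≫ u.f₁ = 0 := by
    rw [Category.assoc, ← Spn.tripleLift_pr₃ T _ _ (S.pr₃ ≫ u.f₁) _ _]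
    exact kernel.condition_assoc (Spn.tripleMap u) _ |>.trans zero_comp
  have hκ : κ = N.tripleLift (kernel.lift _ _ h₁) (kernel.lift _ _ h₂) (kernel.lift _ _ h₃)
      (by simp [N, n, Spn.pr₁_d]) (by simp [N, n, Spn.pr₂_c]) ≫ Spn.tripleMap w := by
    rw [Spn.tripleLift_tripleMap]
    apply Spn.triple_hom_ext
    · rw [Spn.tripleLift_pr₁]; exact (kernel.lift_ι _ _ h₁).symm
    · rw [Spn.tripleLift_pr₂]; exact (kernel.lift_ι _ _ h₂).symm
    · rw [Spn.tripleLift_pr₃]; exact (kernel.lift_ι _ _ h₃).symm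
  change κ ≫ p = 0
  rw [hκ, Category.assoc, hN, comp_zero]

/-- `u` exhibits `T` as the direct image of the span `S` along the strong epimorphism `u.f₁`: the
legs of `T` are the cokernels of the images of the kernels of the legs of `S`. -/
structure IsDirectImage {S T : Spn C} (u : S ⟶ T) : Prop where
  strongEpi : StrongEpi u.f₁
  epi_d : Epi T.d
  epi_c : Epi T.c
  desc_d : ∀ {Z : C} (g : T.S₁ ⟶ Z), kernel.ι S.d ≫ u.f₁ ≫ g = 0 → ∃ l, T.d ≫ l = g
  desc_c : ∀ {Z : C} (g : T.S₁ ⟶ Z), kernel.ι S.c ≫ u.f₁ ≫ g = 0 → ∃ l, T.c ≫ l = g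

/-- A partial Mal'tsev operation along `u.f₁` makes the direct image a pregroupoid. -/
lemma IsDirectImage.exists_pgrd {S T : Spn C} {u : S ⟶ T} (hu : IsDirectImage u)
    (p : S.triple ⟶ T.S₁) (hd : S.abb ≫ p = pullback.fst S.d S.d ≫ u.f₁)
    (hc : S.aab ≫ p = pullback.snd S.c S.c ≫ u.f₁) :
    ∃ q : T.triple ⟶ T.S₁, Spn.tripleMap u ≫ q = p ∧
      T.abb ≫ q = pullback.fst _ _ ∧ T.aab ≫ q = pullback.snd _ _ := by
  have := hu.strongEpi
  have := strongEpi_kernelPair_map S.d u.f₁ T.d u.f₀ u.comm_d hu.desc_d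
  have := strongEpi_kernelPair_map S.c u.f₁ T.c u.f₀' u.comm_c hu.desc_c
  have := strongEpi_tripleMap u
  obtain ⟨q, hq⟩ := exists_desc_of_strongEpi (Spn.tripleMap u) p
    (kernel_tripleMap_comp _ u.f₁ (kernel.condition _) p hd hc)
  refine ⟨q, hq, ?_, ?_⟩
  · rw [← cancel_epi (pullback.map S.d S.d T.d T.d u.f₁ u.f₁ u.f₀ u.comm_d u.comm_d),
      ← Category.assoc, ← abb_tripleMap, Category.assoc, hq, hd, pullback.lift_fst]
  · rw [← cancel_epi (pullback.map S.c S.c T.c T.c u.f₁ u.f₁ u.f₀' u.comm_c u.comm_c),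
      ← Category.assoc, ← aab_tripleMap, Category.assoc, hq, hc, pullback.lift_snd]

/-- If `u.f₁` is universal among the morphisms out of `S.S₁` admitting a partial Mal'tsev operation,
then `u` is universal among the morphisms from `S` to pregroupoids. -/
lemma IsDirectImage.existsUnique_hom {S : Spn C} [Epi S.d] [Epi S.c] {P : Pgrd C}
    {u : S ⟶ P.toSpn} (hu : IsDirectImage u)
    (huniv : ∀ {Z : C} (g : S.S₁ ⟶ Z) (p : S.triple ⟶ Z), S.abb ≫ p = pullback.fst S.d S.d ≫ g →
      S.aab ≫ p = pullback.snd S.c S.c ≫ g → ∃ l, u.f₁ ≫ l = g)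
    (Q : Pgrd C) (f : S ⟶ Q.toSpn) : ∃! g : P ⟶ Q, u ≫ g.toSpnHom = f := by
  have := hu.strongEpi
  have := hu.epi_d
  have := hu.epi_c
  have := strongEpi_kernelPair_map S.d u.f₁ P.toSpn.d u.f₀ u.comm_d hu.desc_d
  have := strongEpi_kernelPair_map S.c u.f₁ P.toSpn.c u.f₀' u.comm_c hu.desc_c
  have := strongEpi_tripleMap u
  obtain ⟨g₁, hg₁⟩ := huniv f.f₁ (Spn.tripleMap f ≫ Q.p) (abb_tripleMap_p f) (aab_tripleMap_p f)
  obtain ⟨g₀, hg₀⟩ := hu.desc_d (g₁ ≫ Q.toSpn.d)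
    (by rw [← Category.assoc u.f₁, hg₁, ← f.comm_d, kernel.condition_assoc, zero_comp])
  obtain ⟨g₀', hg₀'⟩ := hu.desc_c (g₁ ≫ Q.toSpn.c)
    (by rw [← Category.assoc u.f₁, hg₁, ← f.comm_c, kernel.condition_assoc, zero_comp])
  let g : P.toSpn ⟶ Q.toSpn := { f₁ := g₁, f₀ := g₀, f₀' := g₀', comm_d := hg₀, comm_c := hg₀' }
  have hug : u ≫ g = f := by
    apply Spn.hom_ext
    · exact hg₁
    · rw [← cancel_epi S.d]
      change S.d ≫ u.f₀ ≫ g₀ = _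
      rw [← Category.assoc, u.comm_d, Category.assoc, hg₀, ← Category.assoc, hg₁, f.comm_d]
    · rw [← cancel_epi S.c]
      change S.c ≫ u.f₀' ≫ g₀' = _
      rw [← Category.assoc, u.comm_c, Category.assoc, hg₀', ← Category.assoc, hg₁, f.comm_c]
  -- After the epimorphism `tripleMap u`, both sides are partial Mal'tsev operations along `f.f₁`,
  -- hence equal.
  have hgp : P.p ≫ g.f₁ = Spn.tripleMap g ≫ Q.p := by
    rw [← cancel_epi (Spn.tripleMap u), ← Category.assoc (Spn.tripleMap u) (Spn.tripleMap g),
      ← Spn.tripleMap_comp, hug]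
    apply Spn.triple_hom_ext_of_abb_of_aab
    · rw [abb_tripleMap_p, ← Category.assoc (Spn.tripleMap u), ← Category.assoc S.abb,
        abb_tripleMap_p, Category.assoc]
      exact congrArg _ hg₁
    · rw [aab_tripleMap_p, ← Category.assoc (Spn.tripleMap u), ← Category.assoc S.aab,
        aab_tripleMap_p, Category.assoc]
      exact congrArg _ hg₁
  refine ⟨⟨g, hgp⟩, hug, fun h hh => ?_⟩
  have h₁ : h.toSpnHom.f₁ = g.f₁ := by
    rw [← cancel_epi u.f₁]
    exact (congrArg Spn.Hom.f₁ hh).trans hg₁.symm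
  apply Pgrd.Hom.ext
  apply Spn.hom_ext
  · exact h₁
  · rw [← cancel_epi P.toSpn.d, h.toSpnHom.comm_d, h₁, g.comm_d]
  · rw [← cancel_epi P.toSpn.c, h.toSpnHom.comm_c, h₁, g.comm_c]

/-- The universal morphism from a span to pregroupoids, constructed from a universal partial
Mal'tsev operation. -/
lemma exists_isUniversal [HasCokernels C] (S : Spn C) [StrongEpi S.d] [StrongEpi S.c] {B : C}
    (ν : S.S₁ ⟶ B) [StrongEpi ν] (p : S.triple ⟶ B)
    (hd : S.abb ≫ p = pullback.fst S.d S.d ≫ ν) (hc : S.aab ≫ p = pullback.snd S.c S.c ≫ ν)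
    (huniv : ∀ {Z : C} (g : S.S₁ ⟶ Z) (p : S.triple ⟶ Z), S.abb ≫ p = pullback.fst S.d S.d ≫ g →
      S.aab ≫ p = pullback.snd S.c S.c ≫ g → ∃ l, ν ≫ l = g) :
    ∃ F : StructuredArrow S (Pgrd.forget C), Nonempty F.IsUniversal ∧
      ∀ {R : C} (a b : R ⟶ S.S₁), IsKernelPair (Spn.Hom.f₁ F.hom) a b ↔ IsKernelPair ν a b := by
  let T : Spn C := ⟨B, cokernel (kernel.ι S.d ≫ ν), cokernel (kernel.ι S.c ≫ ν),
    cokernel.π _, cokernel.π _⟩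
  obtain ⟨f₀, hf₀⟩ := exists_desc_of_strongEpi S.d (ν ≫ cokernel.π (kernel.ι S.d ≫ ν))
    (by rw [← Category.assoc, cokernel.condition])
  obtain ⟨f₀', hf₀'⟩ := exists_desc_of_strongEpi S.c (ν ≫ cokernel.π (kernel.ι S.c ≫ ν))
    (by rw [← Category.assoc, cokernel.condition])
  let u : S ⟶ T := { f₁ := ν, f₀ := f₀, f₀' := f₀', comm_d := hf₀, comm_c := hf₀' }
  have hu : IsDirectImage u :=
    { strongEpi := ‹_›
      epi_d := inferInstanceAs (Epi (cokernel.π _))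
      epi_c := inferInstanceAs (Epi (cokernel.π _))
      desc_d := fun g hg => ⟨cokernel.desc (kernel.ι S.d ≫ ν) g
        ((Category.assoc _ _ _).trans hg), cokernel.π_desc _ _ _⟩
      desc_c := fun g hg => ⟨cokernel.desc (kernel.ι S.c ≫ ν) g
        ((Category.assoc _ _ _).trans hg), cokernel.π_desc _ _ _⟩ }
  obtain ⟨q, -, hqd, hqc⟩ := hu.exists_pgrd p hd hc
  let P : Pgrd C := ⟨T, q, hqd, hqc⟩
  have key := fun (Q : Pgrd C) (f : S ⟶ Q.toSpn) =>
    IsDirectImage.existsUnique_hom (P := P) hu huniv Q f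
  refine ⟨StructuredArrow.mk (Y := P) (T := Pgrd.forget C) u, ⟨IsInitial.ofUniqueHom
    (fun Y => StructuredArrow.homMk (key Y.right Y.hom).choose (key Y.right Y.hom).choose_spec.1)
    fun Y m => ?_⟩, fun a b => Iff.rfl⟩
  apply StructuredArrow.hom_ext
  exact (key Y.right Y.hom).choose_spec.2 m.right (StructuredArrow.w m)

end Reflection

/-! ### The commutator quotient and the Pedicchio commutator. -/

section Commutator

variable {C : Type u} [Category.{v} C] [HasZeroMorphisms C] [HasFiniteColimits C] [SemiAbelian C]

/-- The morphism is a pushout of the strong epimorphism `q`. -/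
instance {A X Y W : C} (x : X ⟶ A) (y : Y ⟶ A) (w : W ⟶ A) :
    StrongEpi (commutatorQuotient x y w) := by
  refine strongEpi_of_forall_mono _ fun M a j haj _ => ?_
  obtain ⟨l, hl⟩ := exists_factor_of_strongEpi (canonicalMap W X Y) j (copair x y w ≫ a)
    (pushout.inl _ _) (by rw [Category.assoc, haj]; exact pushout.condition.symm)
  have : IsSplitEpi j := ⟨⟨pushout.desc l a (by
      rw [← cancel_mono j, Category.assoc, Category.assoc, hl, haj]
      exact pushout.condition), by
      apply pushout.hom_ext
      · rw [pushout.inl_desc_assoc, hl, Category.comp_id]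
      · rw [pushout.inr_desc_assoc, haj, Category.comp_id]
        rfl⟩⟩
  exact isIso_of_mono_of_isSplitEpi j

lemma exists_desc_commutatorQuotient {A X Y W Z : C} (x : X ⟶ A) (y : Y ⟶ A) (w : W ⟶ A)
    (g : A ⟶ Z) (m : wprod W X Y ⟶ Z) (hm : canonicalMap W X Y ≫ m = copair x y w ≫ g) :
    ∃ l, commutatorQuotient x y w ≫ l = g :=
  ⟨pushout.desc m g hm, pushout.inr_desc _ _ _⟩

/-- The reflection of a span `S` with strongly epic legs into pregroupoids, with middle component
the commutator quotient of the kernels of its legs. -/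
lemma exists_isUniversal_commutatorQuotient (S : Spn C) [StrongEpi S.d] [StrongEpi S.c] :
    ∃ F : StructuredArrow S (Pgrd.forget C), Nonempty F.IsUniversal ∧
      ∀ {R : C} (a b : R ⟶ S.S₁), IsKernelPair (Spn.Hom.f₁ F.hom) a b ↔
        IsKernelPair (commutatorQuotient (kernel.ι S.d) (kernel.ι S.c) (𝟙 S.S₁)) a b := by
  have hw : canonicalMap _ _ _ ≫ pushout.inl (canonicalMap S.S₁ (kernel S.d) (kernel S.c))
      (copair (kernel.ι S.d) (kernel.ι S.c) (𝟙 S.S₁)) =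
      copair (kernel.ι S.d) (kernel.ι S.c) (𝟙 S.S₁) ≫
        commutatorQuotient (kernel.ι S.d) (kernel.ι S.c) (𝟙 S.S₁) := pushout.condition
  have hm := hw
  rw [coprod.desc_comp, coprod.desc_comp, ← isInternalMultiplication_iff] at hm
  -- The other pushout injection is a multiplication along `ν` and descends to a partial Mal'tsev
  -- operation. Conversely, an operation along any `g`, composed with `γ`, gives a cocone on the
  -- pushout, so `g` factors through `ν`.
  obtain ⟨p, -, hd, hc⟩ := exists_desc_gamma S
    (commutatorQuotient (kernel.ι S.d) (kernel.ι S.c) (𝟙 S.S₁)) _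
    (by rw [hm.left, coprod.desc_comp]) (by rw [hm.right, coprod.desc_comp])
  refine exists_isUniversal S _ p hd hc fun g p hd hc => ?_
  refine exists_desc_commutatorQuotient _ _ _ g (gamma S ≫ p) ?_
  rw [coprod.desc_comp, coprod.desc_comp, ← isInternalMultiplication_iff]
  constructor
  · rw [← Category.assoc, wprodLeft_gamma, Category.assoc, hd, ← Category.assoc,
      toKernelPair_fst, coprod.desc_comp]
  · rw [← Category.assoc, wprodRight_gamma, Category.assoc, hc, ← coprod.desc_comp]
    simp only [swap, Category.assoc, pullback.lift_snd_assoc]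
    rw [← Category.assoc, toKernelPair_fst]

namespace EqRel

lemma isPedicchioCommutator_iff_isKernelPair {A : C} (E E' D : EqRel A) :
    IsPedicchioCommutator E E' D ↔
      IsKernelPair (commutatorQuotient E.normalMono E'.normalMono (𝟙 A)) D.fst D.snd := by
  have : StrongEpi (E.quotientSpn E').d := by
    have : IsRegularEpi (coequalizer.π E.fst E.snd) := inferInstance
    exact inferInstanceAs (StrongEpi (coequalizer.π E.fst E.snd))
  have : StrongEpi (E.quotientSpn E').c := by
    have : IsRegularEpi (coequalizer.π E'.fst E'.snd) := inferInstance
    exact inferInstanceAs (StrongEpi (coequalizer.π E'.fst E'.snd))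
  obtain ⟨F, ⟨hF⟩, hFk⟩ := exists_isUniversal_commutatorQuotient (E.quotientSpn E')
  constructor
  · rintro ⟨G, ⟨hG⟩, hGk⟩
    refine (hFk _ _).1 ?_
    -- Two reflections differ by an isomorphism, which does not change the kernel pair of the unit.
    let e := IsInitial.uniqueUpToIso hG hF
    have h₁ : Spn.Hom.f₁ G.hom ≫ e.hom.right.toSpnHom.f₁ = Spn.Hom.f₁ F.hom :=
      congrArg Spn.Hom.f₁ (StructuredArrow.w e.hom)
    have h₂ : e.hom.right.toSpnHom.f₁ ≫ e.inv.right.toSpnHom.f₁ = 𝟙 _ :=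
      congrArg (fun f : G ⟶ G => f.right.toSpnHom.f₁) e.hom_inv_id
    have : IsSplitMono e.hom.right.toSpnHom.f₁ := ⟨⟨_, h₂⟩⟩
    have : Mono e.hom.right.toSpnHom.f₁ := IsSplitMono.mono _
    rw [← h₁]
    exact IsKernelPair.comp_of_mono (f₂ := e.hom.right.toSpnHom.f₁) hGk
  · exact fun h => ⟨F, ⟨hF⟩, (hFk _ _).2 h⟩

end EqRel

end Commutator

/-! ### Normal monomorphisms, equivalence relations and the two commutators. -/

section Subobjects

variable {C : Type u} [Category.{v} C] [HasZeroMorphisms C] [HasFiniteColimits C] [SemiAbelian C]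

omit [HasFiniteColimits C] [SemiAbelian C] in
lemma IsNormalEpi.strongEpi {X Y : C} {f : X ⟶ Y} (h : IsNormalEpi f) : StrongEpi f := by
  have : IsRegularEpi f := ⟨⟨h.some.regularEpi⟩⟩
  infer_instance

omit [SemiAbelian C] in
lemma isNormalEpi_cokernel_π {X Y : C} (f : X ⟶ Y) : IsNormalEpi (cokernel.π f) :=
  ⟨⟨X, f, cokernel.condition f, cokernelIsCokernel f⟩⟩

omit [SemiAbelian C] in
/-- A normal monomorphism is the kernel of its cokernel. -/
lemma IsNormalMono.exists_lift {A X K : C} {x : X ⟶ A} (hx : IsNormalMono x) (k : K ⟶ A)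
    (hk : k ≫ cokernel.π x = 0) : ∃ l, l ≫ x = k := by
  obtain ⟨n⟩ := hx
  have h : k ≫ n.g = 0 := by
    rw [← cokernel.π_desc x n.g n.w, ← Category.assoc, hk, zero_comp]
  exact ⟨_, (KernelFork.IsLimit.lift' n.isLimit k h).2⟩

omit [HasFiniteColimits C] [SemiAbelian C] in
lemma IsNormalMono.mono {A X : C} {x : X ⟶ A} (hx : IsNormalMono x) : Mono x :=
  hx.some.regularMono.mono

lemma IsNormalMono.exists_iso {A X : C} {x : X ⟶ A} (hx : IsNormalMono x) :
    ∃ e : kernel (cokernel.π x) ≅ X, e.hom ≫ x = kernel.ι (cokernel.π x) := by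
  obtain ⟨l, hl⟩ := hx.exists_lift (kernel.ι (cokernel.π x)) (kernel.condition _)
  have := hx.mono
  exact ⟨⟨l, kernel.lift _ x (cokernel.condition x), by
    rw [← cancel_mono (kernel.ι (cokernel.π x))]; simp [hl], by
    rw [← cancel_mono x]; simp [hl]⟩, hl⟩

omit [HasFiniteColimits C] in
lemma mk_kernel_le_mk_kernel {A B B' : C} (f : A ⟶ B) (g : A ⟶ B') (h : kernel.ι f ≫ g = 0) :
    Subobject.mk (kernel.ι f) ≤ Subobject.mk (kernel.ι g) :=
  Subobject.mk_le_mk_of_comm (kernel.lift g (kernel.ι f) h) (kernel.lift_ι _ _ _)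

/-- As `ν` is the cokernel of its kernel, it differs from `cokernel.π (kernel.ι ν)` by the
monomorphism `i`, so both have the same kernel pairs. -/
lemma isKernelPair_iff_same {A B : C} (ν : A ⟶ B) [StrongEpi ν] (D : EqRel A) :
    IsKernelPair ν D.fst D.snd ↔ D.Same (EqRel.ofMono (kernel.ι ν)) := by
  obtain ⟨l, hl⟩ := exists_desc_of_strongEpi ν (cokernel.π (kernel.ι ν)) (cokernel.condition _)
  let i := cokernel.desc (kernel.ι ν) ν (kernel.condition ν)
  have hi : cokernel.π (kernel.ι ν) ≫ i = ν := cokernel.π_desc _ _ _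
  have hil : i ≫ l = 𝟙 _ := by
    rw [← cancel_epi (cokernel.π (kernel.ι ν)), ← Category.assoc, hi, hl, Category.comp_id]
  have : Mono i := (SplitMono.mk l hil).mono
  trans IsKernelPair (cokernel.π (kernel.ι ν)) D.fst D.snd
  · constructor
    · intro h
      rw [← hi] at h
      exact h.cancel_right_of_mono
    · intro h
      rw [← hi]
      exact h.comp_of_mono
  · constructor
    · intro h
      exact ⟨h.isoIsPullback _ _ (IsPullback.of_hasPullback _ _),
        IsPullback.isoIsPullback_hom_fst _ _ _ _, IsPullback.isoIsPullback_hom_snd _ _ _ _⟩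
    · rintro ⟨e, h₁, h₂⟩
      exact IsPullback.of_iso (IsPullback.of_hasPullback (cokernel.π (kernel.ι ν))
        (cokernel.π (kernel.ι ν))) e.symm (Iso.refl _) (Iso.refl _) (Iso.refl _)
        ((Category.comp_id _).trans ((Iso.inv_comp_eq e).2 h₁.symm).symm)
        ((Category.comp_id _).trans ((Iso.inv_comp_eq e).2 h₂.symm).symm)
        (by simp) (by simp)

/-- Both `ν` and `D.proj` are coequalizers of `D`, so each factors through the other. -/
lemma EqRel.mk_normalMono_eq {A B : C} (ν : A ⟶ B) [StrongEpi ν] (D : EqRel A)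
    (h : IsKernelPair ν D.fst D.snd) :
    Subobject.mk D.normalMono = Subobject.mk (kernel.ι ν) := by
  have hreg : IsRegularEpi ν := inferInstance
  apply le_antisymm
  · apply mk_kernel_le_mk_kernel
    have : D.proj ≫ coequalizer.desc ν h.w = ν := coequalizer.π_desc _ _
    rw [← this, kernel.condition_assoc, zero_comp]
  · apply mk_kernel_le_mk_kernel
    have : ν ≫ Cofork.IsColimit.desc h.toCoequalizer' D.proj (coequalizer.condition _ _) = D.proj :=
      Cofork.IsColimit.π_desc' h.toCoequalizer' _ _
    rw [← this, kernel.condition_assoc, zero_comp]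

omit [HasFiniteColimits C] in
lemma canonicalMap_wprodMap {W X Y W' X' Y' : C} (h : W ⟶ W') (f : X ⟶ X') (g : Y ⟶ Y') :
    canonicalMap W X Y ≫ wprodMap h f g =
      coprod.map (coprod.map h f) g ≫ canonicalMap W' X' Y' := by
  apply pullback.hom_ext
  · simp only [canonicalMap, wprodMap, pullback.map, Category.assoc, pullback.lift_fst,
      pullback.lift_fst_assoc]
    apply coprod.hom_ext
    · apply coprod.hom_ext <;> simp
    · simp
  · simp only [canonicalMap, wprodMap, pullback.map, Category.assoc, pullback.lift_snd,
      pullback.lift_snd_assoc]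
    apply coprod.hom_ext
    · apply coprod.hom_ext <;> simp
    · simp

/-- The weighted normal commutator is monotone. -/
lemma normalCommutator_le {A X Y X' Y' W : C} {x : X ⟶ A} {y : Y ⟶ A} {x' : X' ⟶ A} {y' : Y' ⟶ A}
    (w : W ⟶ A) (e : X ⟶ X') (he : e ≫ x' = x) (e' : Y ⟶ Y') (he' : e' ≫ y' = y) :
    Subobject.mk (normalCommutator x y w) ≤ Subobject.mk (normalCommutator x' y' w) := by
  apply mk_kernel_le_mk_kernel
  obtain ⟨l, hl⟩ := exists_desc_commutatorQuotient x y w (commutatorQuotient x' y' w)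
    (wprodMap (𝟙 W) e e' ≫ pushout.inl _ _) (by
      rw [← Category.assoc, canonicalMap_wprodMap, Category.assoc, pushout.condition,
        ← Category.assoc, commutatorQuotient]
      congr 1
      rw [coprod.map_desc, coprod.map_desc, he, he', Category.id_comp])
  rw [← hl, kernel.condition_assoc, zero_comp]

lemma exists_factor_normalMono_ofMono {A X : C} (x : X ⟶ A) :
    ∃ e, e ≫ (EqRel.ofMono x).normalMono = x := by
  have hreg : IsRegularEpi (cokernel.π x) := ⟨⟨(isNormalEpi_cokernel_π x).some.regularEpi⟩⟩
  have hk : IsKernelPair (cokernel.π x) (EqRel.ofMono x).fst (EqRel.ofMono x).snd :=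
    IsPullback.of_hasPullback _ _
  have : cokernel.π x ≫ Cofork.IsColimit.desc hk.toCoequalizer' (EqRel.ofMono x).proj
      (coequalizer.condition _ _) = (EqRel.ofMono x).proj :=
    Cofork.IsColimit.π_desc' hk.toCoequalizer' _ _
  exact ⟨kernel.lift _ x (by rw [← this, cokernel.condition_assoc, zero_comp]),
    kernel.lift_ι _ _ _⟩

lemma IsNormalMono.exists_factor {A X : C} {x : X ⟶ A} (hx : IsNormalMono x) :
    ∃ e, e ≫ x = (EqRel.ofMono x).normalMono := by
  apply hx.exists_lift
  have : (EqRel.ofMono x).proj ≫ coequalizer.desc (cokernel.π x) (pullback.condition) =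
    cokernel.π x := coequalizer.π_desc _ _
  rw [← this, EqRel.normalMono, kernel.condition_assoc, zero_comp]

/-- The `1`-weighted subobject commutator is normal. -/
lemma normalCommutator_eq_subobjectCommutator {A X Y : C} (x : X ⟶ A) (y : Y ⟶ A) :
    Subobject.mk (normalCommutator x y (𝟙 A)) = Subobject.mk (subobjectCommutator x y (𝟙 A)) := by
  have hc : canonicalMap A X Y ≫ pushout.inl _ _ =
      copair x y (𝟙 A) ≫ commutatorQuotient x y (𝟙 A) := pushout.condition
  -- The weight `1` is used here: the summand `A` splits `[1, x, y]`. Direct images along this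
  -- epimorphism preserve kernels, so the kernel of `q` covers the kernel of `ν`.
  have hsplit : IsSplitEpi (copair x y (𝟙 A)) := ⟨⟨coprod.inl ≫ coprod.inl, by
    rw [Category.assoc, coprod.inl_desc, coprod.inl_desc]⟩⟩
  have hreg : IsRegularEpi (copair x y (𝟙 A)) := inferInstance
  have := strongEpi_kernel_map_of_cokernel (canonicalMap A X Y) (copair x y (𝟙 A))
    (commutatorQuotient x y (𝟙 A)) _ hc fun g hg => by
      obtain ⟨m, hm⟩ := exists_desc_of_strongEpi (canonicalMap A X Y) _ hg
      exact exists_desc_commutatorQuotient x y (𝟙 A) g m hm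
  apply le_antisymm
  · obtain ⟨l, hl⟩ := exists_factor_of_strongEpi (kernel.map _ _ _ _ hc)
      (subobjectCommutator x y (𝟙 A)) (factorThruImage _) (normalCommutator x y (𝟙 A)) (by
        rw [subobjectCommutator, image.fac, normalCommutator, kernel.map, kernel.lift_ι])
    exact Subobject.mk_le_mk_of_comm l hl
  · refine Subobject.mk_le_mk_of_comm (image.lift
      { I := _
        m := normalCommutator x y (𝟙 A)
        e := kernel.map _ _ _ _ hc
        fac := by rw [normalCommutator, kernel.map, kernel.lift_ι] }) (image.lift_fac _)

end Subobjects

/-! ### The two equivalences of categories. -/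

section Equivalences

variable {C : Type u} [Category.{v} C] [HasZeroMorphisms C]

omit [HasZeroMorphisms C] in
lemma spn_hom_ext_of_epi {S T : Spn C} [Epi S.d] [Epi S.c] {f g : S ⟶ T} (h : f.f₁ = g.f₁) :
    f = g := by
  apply Spn.hom_ext h
  · rw [← cancel_epi S.d, f.comm_d, g.comm_d, h]
  · rw [← cancel_epi S.c, f.comm_c, g.comm_c, h]

/-- The legs of `S` are cokernels of their kernels, so a morphism respecting the kernels induces the
outer components. The weight component is forced because both weights are identities. -/
lemma exists_kernelCospan_map_eq [SemiAbelian C] {S T : Spn C} [StrongEpi S.d] [StrongEpi S.c]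
    (φ : (kernelCospan C).obj S ⟶ (kernelCospan C).obj T) :
    ∃ f : S ⟶ T, (kernelCospan C).map f = φ := by
  let f₁ : S.S₁ ⟶ T.S₁ := φ.fA
  let fX : kernel S.d ⟶ kernel T.d := φ.fX
  let fY : kernel S.c ⟶ kernel T.c := φ.fY
  have hx : kernel.ι S.d ≫ f₁ = fX ≫ kernel.ι T.d := φ.comm_x
  have hy : kernel.ι S.c ≫ f₁ = fY ≫ kernel.ι T.c := φ.comm_y
  have hw : f₁ = φ.fW := (Category.id_comp _).symm.trans (φ.comm_w.trans (Category.comp_id _))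
  obtain ⟨f₀, h₀⟩ := exists_desc_of_strongEpi S.d (f₁ ≫ T.d)
    (by rw [← Category.assoc, hx, Category.assoc, kernel.condition, comp_zero])
  obtain ⟨f₀', h₀'⟩ := exists_desc_of_strongEpi S.c (f₁ ≫ T.c)
    (by rw [← Category.assoc, hy, Category.assoc, kernel.condition, comp_zero])
  refine ⟨{ f₁ := f₁, f₀ := f₀, f₀' := f₀', comm_d := h₀, comm_c := h₀' }, ?_⟩
  apply WCospan.hom_ext
  · rfl
  · refine (cancel_mono (kernel.ι T.d)).1 ?_
    exact (kernel.lift_ι _ _ _).trans hx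
  · refine (cancel_mono (kernel.ι T.c)).1 ?_
    exact (kernel.lift_ι _ _ _).trans hy
  · exact hw

/-- Constructor for isomorphisms of `1`-weighted cospans with the same vertex. -/
def WCospan.isoOfOneWeighted {A X Y X' Y' : C} {x : X ⟶ A} {y : Y ⟶ A} {x' : X' ⟶ A} {y' : Y' ⟶ A}
    (eX : X ≅ X') (eY : Y ≅ Y') (hx : eX.hom ≫ x' = x) (hy : eY.hom ≫ y' = y) :
    (⟨A, X, Y, A, x, y, 𝟙 A⟩ : WCospan C) ≅ ⟨A, X', Y', A, x', y', 𝟙 A⟩ where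
  hom := ⟨𝟙 A, eX.hom, eY.hom, 𝟙 A, by simp [hx], by simp [hy], rfl⟩
  inv := ⟨𝟙 A, eX.inv, eY.inv, 𝟙 A, by simp [← hx], by simp [← hy], rfl⟩
  hom_inv_id := WCospan.hom_ext (Category.comp_id _) eX.hom_inv_id eY.hom_inv_id
    (Category.comp_id _)
  inv_hom_id := WCospan.hom_ext (Category.comp_id _) eX.inv_hom_id eY.inv_hom_id
    (Category.comp_id _)

/-- An isomorphism of weighted cospans compatible with multiplications is an isomorphism of
multiplicative weighted cospans. -/
def MWCospan.isoMk [HasBinaryCoproducts C] [HasPullbacks C] {S T : MWCospan C}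
    (e : S.toWCospan ≅ T.toWCospan)
    (h : S.m ≫ e.hom.fA = wprodMap e.hom.fW e.hom.fX e.hom.fY ≫ T.m) : S ≅ T where
  hom := ⟨e.hom, h⟩
  inv := ⟨e.inv, by
    have h₁ : wprodMap e.inv.fW e.inv.fX e.inv.fY ≫ wprodMap e.hom.fW e.hom.fX e.hom.fY = 𝟙 _ := by
      rw [← wprodMap_comp, ← wprodMap_id]
      exact congrArg (fun f : T.toWCospan ⟶ T.toWCospan => wprodMap f.fW f.fX f.fY) e.inv_hom_id
    have h₂ : e.hom.fA ≫ e.inv.fA = 𝟙 _ := congrArg WCospan.Hom.fA e.hom_inv_id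
    calc T.m ≫ e.inv.fA
        = (wprodMap e.inv.fW e.inv.fX e.inv.fY ≫ wprodMap e.hom.fW e.hom.fX e.hom.fY) ≫
            T.m ≫ e.inv.fA := by rw [h₁, Category.id_comp]
      _ = wprodMap e.inv.fW e.inv.fX e.inv.fY ≫ (S.m ≫ e.hom.fA) ≫ e.inv.fA := by
          rw [h]; simp only [Category.assoc]
      _ = _ := by rw [Category.assoc, h₂, Category.comp_id]⟩
  hom_inv_id := MWCospan.Hom.ext e.hom_inv_id
  inv_hom_id := MWCospan.Hom.ext e.inv_hom_id

variable [HasFiniteColimits C] [SemiAbelian C]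

theorem isEquivalence_nEpiSpnToNMonoCospan : (nEpiSpnToNMonoCospan C).IsEquivalence where
  faithful := ⟨fun {S T f g} h => by
    have := S.property.1.strongEpi
    have := S.property.2.strongEpi
    apply ObjectProperty.hom_ext
    exact spn_hom_ext_of_epi
      (congrArg (fun φ => WCospan.Hom.fA (InducedCategory.Hom.hom φ)) h)⟩
  full := ⟨fun {S T} φ => by
    have := S.property.1.strongEpi
    have := S.property.2.strongEpi
    obtain ⟨f, hf⟩ := exists_kernelCospan_map_eq (S := S.obj) (T := T.obj) φ.hom
    exact ⟨ObjectProperty.homMk f, ObjectProperty.hom_ext _ hf⟩⟩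
  essSurj := ⟨by
    rintro ⟨_, ⟨A, X, Y, x, y, rfl⟩, hx, hy⟩
    obtain ⟨eX, heX⟩ := IsNormalMono.exists_iso hx
    obtain ⟨eY, heY⟩ := IsNormalMono.exists_iso hy
    exact ⟨⟨⟨A, cokernel x, cokernel y, cokernel.π x, cokernel.π y⟩,
      isNormalEpi_cokernel_π x, isNormalEpi_cokernel_π y⟩,
      ⟨ObjectProperty.isoMk _ (WCospan.isoOfOneWeighted eX eY heX heY)⟩⟩⟩

omit [HasFiniteColimits C] in
/-- A multiplication on the kernels of the legs of a span is induced by a pregroupoid structure. -/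
lemma exists_pgrd_of_isInternalMultiplication (S : Spn C)
    (m : wprod S.S₁ (kernel S.d) (kernel S.c) ⟶ S.S₁)
    (hm : IsInternalMultiplication (kernel.ι S.d) (kernel.ι S.c) (𝟙 S.S₁) m) :
    ∃ p : S.triple ⟶ S.S₁, gamma S ≫ p = m ∧ S.abb ≫ p = pullback.fst S.d S.d ∧
      S.aab ≫ p = pullback.snd S.c S.c := by
  obtain ⟨p, h₁, h₂, h₃⟩ := exists_desc_gamma S (𝟙 _) m (by rw [hm.left, Category.comp_id])
    (by rw [hm.right, Category.comp_id])
  exact ⟨p, h₁, by rw [h₂, Category.comp_id], by rw [h₃, Category.comp_id]⟩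

theorem isEquivalence_nEpiPgrdToNMonoMCospan : (nEpiPgrdToNMonoMCospan C).IsEquivalence where
  faithful := ⟨fun {S T f g} h => by
    have := S.property.1.strongEpi
    have := S.property.2.strongEpi
    apply ObjectProperty.hom_ext
    apply Pgrd.Hom.ext
    exact spn_hom_ext_of_epi
      (congrArg (fun φ => WCospan.Hom.fA (MWCospan.Hom.toWHom (InducedCategory.Hom.hom φ))) h)⟩
  full := ⟨fun {S T} φ => by
    have := S.property.1.strongEpi
    have := S.property.2.strongEpi
    obtain ⟨f, hf⟩ := exists_kernelCospan_map_eq (S := S.obj.toSpn) (T := T.obj.toSpn) φ.hom.toWHom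
    have hm : (gamma S.obj.toSpn ≫ S.obj.p) ≫ φ.hom.toWHom.fA =
      wprodMap φ.hom.toWHom.fW φ.hom.toWHom.fX φ.hom.toWHom.fY ≫ gamma T.obj.toSpn ≫ T.obj.p :=
      φ.hom.comm_m
    -- As `γ` is epic, preserving `p` is equivalent to preserving the multiplication `p ∘ γ`.
    have hp : S.obj.p ≫ f.f₁ = Spn.tripleMap f ≫ T.obj.p := by
      rw [← cancel_epi (gamma S.obj.toSpn), ← Category.assoc, ← Category.assoc, gamma_naturality,
        Category.assoc _ _ T.obj.p]
      rw [← hf] at hm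
      exact hm
    exact ⟨ObjectProperty.homMk ⟨f, hp⟩, ObjectProperty.hom_ext _ (MWCospan.Hom.ext hf)⟩⟩
  essSurj := ⟨by
    rintro ⟨⟨S, m, hm⟩, ⟨A, X, Y, x, y, hS⟩, hx, hy⟩
    obtain rfl : S = ⟨A, X, Y, A, x, y, 𝟙 A⟩ := hS
    obtain ⟨eX, heX⟩ := IsNormalMono.exists_iso hx
    obtain ⟨eY, heY⟩ := IsNormalMono.exists_iso hy
    let S : Spn C := ⟨A, cokernel x, cokernel y, cokernel.π x, cokernel.π y⟩
    -- The multiplication is transported to the kernels of the cokernels of `x` and `y`, then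
    -- descended along `γ`.
    obtain ⟨p, hp, hd, hc⟩ := exists_pgrd_of_isInternalMultiplication S
      (wprodMap (𝟙 A) eX.hom eY.hom ≫ m) (by
        rw [isInternalMultiplication_iff] at hm ⊢
        rw [← Category.assoc, canonicalMap_wprodMap, Category.assoc]
        refine (congrArg _ hm).trans ?_
        refine (coprod.map_desc _ _ _ _).trans ?_
        congr 1
        exact (coprod.map_desc _ _ _ _).trans (by congr 1; exact Category.id_comp _))
    refine ⟨⟨⟨S, p, hd, hc⟩, isNormalEpi_cokernel_π x, isNormalEpi_cokernel_π y⟩,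
      ⟨ObjectProperty.isoMk _ (MWCospan.isoMk (WCospan.isoOfOneWeighted eX eY heX heY) ?_)⟩⟩
    exact (Category.comp_id _).trans hp⟩

end Equivalences

end WeightedCommutator

end

/-! ### The main theorem. -/

theorem mainTheorem2 (C : Type u) [Category.{v} C] [HasZeroMorphisms C] [HasFiniteColimits C]
    [WeightedCommutator.SemiAbelian C] :
    (WeightedCommutator.nEpiSpnToNMonoCospan C).IsEquivalence ∧
    (WeightedCommutator.nEpiPgrdToNMonoMCospan C).IsEquivalence ∧
    (∀ (A : C) (E E' D : WeightedCommutator.EqRel A),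
      WeightedCommutator.EqRel.IsPedicchioCommutator E E' D ↔
        D.Same (WeightedCommutator.EqRel.ofMono
          (WeightedCommutator.normalCommutator E.normalMono E'.normalMono (𝟙 A)))) ∧
    (∀ (A X Y : C) (x : X ⟶ A) (y : Y ⟶ A),
      WeightedCommutator.IsNormalMono x → WeightedCommutator.IsNormalMono y →
        WeightedCommutator.IsNormalMono (WeightedCommutator.normalCommutator x y (𝟙 A)) ∧
        (∃ D : WeightedCommutator.EqRel A, WeightedCommutator.EqRel.IsPedicchioCommutator
          (WeightedCommutator.EqRel.ofMono x) (WeightedCommutator.EqRel.ofMono y) D) ∧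
        (∀ D : WeightedCommutator.EqRel A, WeightedCommutator.EqRel.IsPedicchioCommutator
            (WeightedCommutator.EqRel.ofMono x) (WeightedCommutator.EqRel.ofMono y) D →
          Subobject.mk D.normalMono =
            Subobject.mk (WeightedCommutator.normalCommutator x y (𝟙 A)))) ∧
    (∀ (A X Y : C) (x : X ⟶ A) (y : Y ⟶ A),
      WeightedCommutator.IsNormalMono x → WeightedCommutator.IsNormalMono y →
        Subobject.mk (WeightedCommutator.normalCommutator x y (𝟙 A)) =
          Subobject.mk (WeightedCommutator.subobjectCommutator x y (𝟙 A))) := by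
  refine ⟨WeightedCommutator.isEquivalence_nEpiSpnToNMonoCospan,
    WeightedCommutator.isEquivalence_nEpiPgrdToNMonoMCospan, fun A E E' D => ?_,
    fun A X Y x y hx hy => ⟨WeightedCommutator.isNormalMono_kernel_ι _, ?_, fun D hD => ?_⟩,
    fun A X Y x y _ _ => WeightedCommutator.normalCommutator_eq_subobjectCommutator x y⟩
  · rw [WeightedCommutator.EqRel.isPedicchioCommutator_iff_isKernelPair,
      WeightedCommutator.isKernelPair_iff_same]
    rfl
  · exact ⟨WeightedCommutator.EqRel.kernelPair _,
      (WeightedCommutator.EqRel.isPedicchioCommutator_iff_isKernelPair _ _ _).2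
        (IsPullback.of_hasPullback _ _)⟩
  · rw [WeightedCommutator.EqRel.isPedicchioCommutator_iff_isKernelPair] at hD
    -- `hD` concerns the normal monomorphisms of `ofMono x` and `ofMono y`. These factor through `x`
    -- and `y` and conversely, so monotonicity of the commutator gives equality.
    obtain ⟨e₁, h₁⟩ := WeightedCommutator.exists_factor_normalMono_ofMono x
    obtain ⟨e₂, h₂⟩ := WeightedCommutator.exists_factor_normalMono_ofMono y
    obtain ⟨e₃, h₃⟩ := hx.exists_factor
    obtain ⟨e₄, h₄⟩ := hy.exists_factor
    exact (WeightedCommutator.EqRel.mk_normalMono_eq _ D hD).trans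
      (le_antisymm (WeightedCommutator.normalCommutator_le _ e₃ h₃ e₄ h₄)
        (WeightedCommutator.normalCommutator_le _ e₁ h₁ e₂ h₂))
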